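/- \textbf{Model.} Let $V_1,V_2$ be finite vertex sets, $S^*\subseteq V_1$, and $\pi^*:S^*\to V_2$ injective; write $\binom{S}{2}$ for the set of two-element subsets of $S$, and $\pi(\{u,v\})=\{\pi(u),\pi(v)\}$ for the action of an injection on pairs. Random graphs $G_1,G_2$ on $V_1,V_2$ are given by their edge weights $\beta_e(G_1)$, $e\in\binom{V_1}{2}$, and $\beta_{e}(G_2)$, $e\in\binom{V_2}{2}$. Let $0<p,\rho<1$. In the \emph{Erdős–Rényi model} each weight is Bernoulli with mean $p$ (an edge has weight $1$, a non-edge weight $0$), and for every $e\in\binom{S^*}{2}$ the pair $(\beta_e(G_1),\beta_{\pi^*(e)}(G_2))$ takes the values $(1,1),(1,0),(0,1),(0,0)$ with probabilities $p^2+\rho p(1-p)$, $(1-\rho)p(1-p)$, $(1-\rho)p(1-p)$, $(1-p)^2+\rho p(1-p)$. In the \emph{Gaussian Wigner model} each weight is standard normal, and each such pair is centred bivariate normal with unit variances and correlation $\rho$. In both models the correlated pairs and all remaining weights are mutually independent. Let $\nu$ be the law of a correlated pair. \textbf{Scores and digraph.} Let $S\subseteq V_1$, let $\pi:S\to V_2$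 be injective, and let $f:\mathbb R\times\mathbb R\to\mathbb R$. For $\mathcal E\subseteq\binom{S}{2}$ put $\beta_{\mathcal E}(\mathcal H_\pi^f)=\sum_{e\in\mathcal E}f(\beta_e(G_1),\beta_{\pi(e)}(G_2))$. The correlated functional digraph has as vertices the pairs of vertices of $G_1$ and of $G_2$, where each $e\in\binom{S^*}{2}$ is merged with $\pi^*(e)$, and an arc $e\mapsto\pi(e)$ for each $e\in\binom{S}{2}$. Sets of arcs are identified with sets of pairs $e\in\binom S2$; a directed path has at least one arc and pairwise distinct vertices; a self-loop is a directed cycle of order $1$; the order is the number of arcs. \textbf{Cumulant generating functions.} Let $(A_i,B_i)$ be independent with law $\nu$, and let $$\kappa^{\mathsf P}_\ell(t)=\log\mathbb E\exp\Big(t\sum_{i=0}^{\ell-1}f(A_i,B_{i+1})\Big),\qquad \kappa^{\mathsf C}_\ell(t)=\log\mathbb E\exp\Big(t\sum_{i=0}^{\ell-1}f(A_i,B_{i+1\bmod \ell})\Big).$$ \textbf{Lemma.} Let $0<p,\rho<1$ and assume one of the following: \begin{itemize} \item the Erdős–Rényi model, $f(x,y)=xy$ and $t>0$; \item the Gaussian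 Wigner model, $f(x,y)=xy$ and $0<t<\frac1{1+\rho}$; \item the Gaussian Wigner model, $f(x,y)=-\frac12(x-y)^2$ and $t>0$. \end{itemize} Then the expectations defining $\kappa^{\mathsf P}_\ell(t)$ and $\kappa^{\mathsf C}_\ell(t)$ are finite for all $\ell$, and $$\kappa^{\mathsf P}_1(t)\le\tfrac12\kappa^{\mathsf C}_2(t)\le\kappa^{\mathsf C}_1(t)\quad\text{and}\quad \kappa^{\mathsf P}_\ell(t)\le\kappa^{\mathsf C}_\ell(t)\le\tfrac{\ell}{2}\kappa^{\mathsf C}_2(t)\quad\text{for all }\ell\ge2.$$ Moreover $\log\mathbb E e^{t\beta_P(\mathcal H_\pi^f)}=\kappa^{\mathsf P}_{|P|}(t)$ for every directed path $P$ and $\log\mathbb E e^{t\beta_C(\mathcal H_\pi^f)}=\kappa^{\mathsf C}_{|C|}(t)$ for every directed cycle $C$ of the correlated functional digraph. Consequently, for every $\mathcal E\subseteq\binom S2$, the expectation below is finite and $$\log\mathbb E e^{t\beta_{\mathcal E}(\mathcal H_\pi^f)}\le\frac{|\mathcal E|}2\kappa^{\mathsf C}_2(t)+L\Big(\kappa^{\mathsf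 C}_1(t)-\tfrac12\kappa^{\mathsf C}_2(t)\Big),$$ where $L$ is the number of self-loops of the digraph among the arcs $e\mapsto\pi(e)$, $e\in\mathcal E$. -/

import Mathlib

open MeasureTheory ProbabilityTheory

noncomputable section

namespace CorrelatedGraphs

section Laws

/-- The Bernoulli law with mean `p`, as a law on `ℝ`. -/
def bernoulliLaw (p : ℝ) : Measure ℝ :=
  ENNReal.ofReal p • Measure.dirac 1 + ENNReal.ofReal (1 - p) • Measure.dirac 0

/-- The bivariate Bernoulli law `Bern(p, p, ρ)`: both means are `p` and the correlation
coefficient is `ρ`. -/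
def bivariateBernoulliLaw (p ρ : ℝ) : Measure (ℝ × ℝ) :=
  ENNReal.ofReal (p ^ 2 + ρ * p * (1 - p)) • Measure.dirac (1, 1)
    + ENNReal.ofReal ((1 - ρ) * p * (1 - p)) • Measure.dirac (1, 0)
    + ENNReal.ofReal ((1 - ρ) * p * (1 - p)) • Measure.dirac (0, 1)
    + ENNReal.ofReal ((1 - p) ^ 2 + ρ * p * (1 - p)) • Measure.dirac (0, 0)

/-- The centred bivariate normal law with unit variances and correlation coefficient `ρ`. -/
def bivariateNormalLaw (ρ : ℝ) : Measure (ℝ × ℝ) :=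
  (multivariateGaussian 0 !![1, ρ; ρ, 1]).map (fun v : EuclideanSpace ℝ (Fin 2) => (v 0, v 1))

end Laws

section Cumulants

/-- The similarity score of a path of order `ℓ`. The pairs `w i = (A i, B i)`, `0 ≤ i ≤ ℓ`, are
pairs of correlated edge weights, and the arcs of the path have the scores `f (A i) (B (i + 1))`,
`0 ≤ i < ℓ`. The coordinates `B 0` and `A ℓ` do not occur in the score. -/
def pathScore (f : ℝ → ℝ → ℝ) (ℓ : ℕ) (w : Fin (ℓ + 1) → ℝ × ℝ) : ℝ :=
  ∑ i : Fin ℓ, f (w i.castSucc).1 (w i.succ).2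

/-- The similarity score of a cycle of order `ℓ`: as for paths, with indices modulo `ℓ`. -/
def cycleScore (f : ℝ → ℝ → ℝ) (ℓ : ℕ) (w : Fin ℓ → ℝ × ℝ) : ℝ :=
  ∑ i : Fin ℓ, f (w i).1 (w (finRotate ℓ i)).2

/-- `κ^P_ℓ(t)`: the cumulant generating function of the score of a path of order `ℓ`, where the
pairs of correlated weights are independent with common law `ν`. -/
def pathCGF (ν : Measure (ℝ × ℝ)) (f : ℝ → ℝ → ℝ) (ℓ : ℕ) (t : ℝ) : ℝ :=
  cgf (pathScore f ℓ) (Measure.pi fun _ => ν) t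

/-- `κ^C_ℓ(t)`: the cumulant generating function of the score of a cycle of order `ℓ`. -/
def cycleCGF (ν : Measure (ℝ × ℝ)) (f : ℝ → ℝ → ℝ) (ℓ : ℕ) (t : ℝ) : ℝ :=
  cgf (cycleScore f ℓ) (Measure.pi fun _ => ν) t

end Cumulants

section Graphs

variable {V V₁ V₂ : Type*} [DecidableEq V] [DecidableEq V₁] [DecidableEq V₂]

/-- The set of two-element subsets of `S`. -/
def pairs (S : Finset V) : Finset (Sym2 V) := S.sym2.filter fun e => ¬ e.IsDiag

/-- A partially correlated pair of random graphs on the finite vertex sets `V₁` and `V₂`, given by their edge weights `A` (first graph) and `B` (second graph); an unweighted graph has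
the weights `1` (edge) and `0` (no edge). Each edge weight has the law `m`; for `e` a pair of
elements of `Sstar`, the weights of `e` and of its image under the injection `πstar` have the joint
law `ν`; apart from these correlations all edge weights are independent.
Values of `πstar` outside `Sstar` and weights on the diagonal play no role. -/
structure IsPartiallyCorrelated {Ω : Type*} [MeasurableSpace Ω] [Fintype V₁] [Fintype V₂]
    (μ : Measure Ω) (m : Measure ℝ) (ν : Measure (ℝ × ℝ))
    (A : Sym2 V₁ → Ω → ℝ) (B : Sym2 V₂ → Ω → ℝ)
    (Sstar : Finset V₁) (πstar : V₁ → V₂) : Prop where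
  injOn : Set.InjOn πstar Sstar
  measurable_fst : ∀ e ∈ pairs (Finset.univ : Finset V₁), Measurable (A e)
  measurable_snd : ∀ e ∈ pairs (Finset.univ : Finset V₂), Measurable (B e)
  law_fst : ∀ e ∈ pairs (Finset.univ : Finset V₁), μ.map (A e) = m
  law_snd : ∀ e ∈ pairs (Finset.univ : Finset V₂), μ.map (B e) = m
  law_pair : ∀ e ∈ pairs Sstar, μ.map (fun ω => (A e ω, B (e.map πstar) ω)) = ν
  /-- The correlated pairs, the other weights of the first graph and the other weights of the
  second graph are mutually independent (single weights are padded by the constant `0`). -/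
  indep : iIndepFun
    (fun (k : {e // e ∈ pairs Sstar} ⊕
          {e // e ∈ pairs (Finset.univ : Finset V₁) \ pairs Sstar} ⊕
          {e // e ∈ pairs (Finset.univ : Finset V₂) \ pairs (Sstar.image πstar)}) (ω : Ω) =>
      match k with
      | .inl e => (A e.1 ω, B (e.1.map πstar) ω)
      | .inr (.inl e) => (A e.1 ω, (0 : ℝ))
      | .inr (.inr e) => ((0 : ℝ), B e.1 ω)) μ

/-- The weight of the pair `e` in the `f`-intersected graph of the partial injection `π : S → V₂`.
Pairs that are no edges of an unweighted first graph have weight `0` there, and they get the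
weight `0` here as soon as `f 0 y = 0`. -/
def interWeight {Ω : Type*} (f : ℝ → ℝ → ℝ) (A : Sym2 V₁ → Ω → ℝ) (B : Sym2 V₂ → Ω → ℝ)
    (S : Finset V₁) (π : V₁ → V₂) (e : Sym2 V₁) (ω : Ω) : ℝ :=
  if e ∈ pairs S then f (A e ω) (B (e.map π) ω) else 0

/-- The total weight of the set `E` of pairs in the `f`-intersected graph. -/
def totalWeight {Ω : Type*} (f : ℝ → ℝ → ℝ) (A : Sym2 V₁ → Ω → ℝ) (B : Sym2 V₂ → Ω → ℝ)
    (S : Finset V₁) (π : V₁ → V₂) (E : Finset (Sym2 V₁)) (ω : Ω) : ℝ :=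
  ∑ e ∈ E, interWeight f A B S π e ω

/-- The merging relation: a pair `e` of elements of `Sstar` is merged with its image. -/
def MergeRel (Sstar : Finset V₁) (πstar : V₁ → V₂) (x y : Sym2 V₁ ⊕ Sym2 V₂) : Prop :=
  ∃ e ∈ pairs Sstar, x = .inl e ∧ y = .inr (e.map πstar)

/-- The vertices of the correlated functional digraph: pairs of vertices of the first graph and
pairs of vertices of the second graph, after merging. (Those that are incident to no arc are
isolated and play no role.) -/
def Node (Sstar : Finset V₁) (πstar : V₁ → V₂) : Type _ := Quot (MergeRel Sstar πstar)

/-- The initial vertex of the arc `e ↦ π e`. -/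
def arcTail (Sstar : Finset V₁) (πstar : V₁ → V₂) (e : Sym2 V₁) : Node Sstar πstar :=
  Quot.mk _ (.inl e)

/-- The final vertex of the arc `e ↦ π e`. -/
def arcHead (Sstar : Finset V₁) (πstar : V₁ → V₂) (π : V₁ → V₂) (e : Sym2 V₁) :
    Node Sstar πstar :=
  Quot.mk _ (.inr (e.map π))

/-- The arcs `e ↦ π e`, `e ∈ P`, form a directed path of the correlated functional digraph of
`π : S → V₂`: they can be listed as consecutive arcs through distinct vertices. -/
def IsPath (Sstar : Finset V₁) (πstar : V₁ → V₂) (S : Finset V₁) (π : V₁ → V₂)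
    (P : Finset (Sym2 V₁)) : Prop :=
  P ⊆ pairs S ∧ P.Nonempty ∧
    ∃ (e : Fin P.card → Sym2 V₁) (v : Fin (P.card + 1) → Node Sstar πstar),
      Finset.univ.image e = P ∧ Function.Injective v ∧
      ∀ i, arcTail Sstar πstar (e i) = v i.castSucc ∧ arcHead Sstar πstar π (e i) = v i.succ

/-- The arcs `e ↦ π e`, `e ∈ C`, form a directed cycle of the correlated functional digraph of
`π : S → V₂`; a self-loop is a cycle of order one. -/
def IsCycle (Sstar : Finset V₁) (πstar : V₁ → V₂) (S : Finset V₁) (π : V₁ → V₂)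
    (C : Finset (Sym2 V₁)) : Prop :=
  C ⊆ pairs S ∧ C.Nonempty ∧
    ∃ (e : Fin C.card → Sym2 V₁) (v : Fin C.card → Node Sstar πstar),
      Finset.univ.image e = C ∧ Function.Injective v ∧
      ∀ i, arcTail Sstar πstar (e i) = v i ∧ arcHead Sstar πstar π (e i) = v (finRotate _ i)

open Classical in
/-- The number of self-loops of the correlated functional digraph among the arcs in `E`. -/
def selfLoops (Sstar : Finset V₁) (πstar : V₁ → V₂) (π : V₁ → V₂) (E : Finset (Sym2 V₁)) : ℕ :=
  (E.filter fun e => arcTail Sstar πstar e = arcHead Sstar πstar π e).card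

end Graphs

end CorrelatedGraphs

end

open CorrelatedGraphs

/-! Both laws `ν` are mixtures: given a latent variable `x` with law `m`, the weights `A` and `B` of
a correlated pair are independent and identically distributed. Integrating out the noise first turns
`exp (t * f)` into a kernel `M x y` on the latent variables, the conditional mean of `exp (t * f A
B')` for two pairs with latent values `x` and `y`. This is `latentKernel`; the averaging is
legitimate because in a path or cycle each individual weight enters at most one score
(`lintegral_pi_latentLaw`).

The moment generating function of a path of order `ℓ` is then `⟨1, M ^ ℓ 1⟩` in `L²(m)`, that of a
cycle is `tr (M ^ ℓ)`, and in particular the one of the 2-cycle is the squared Hilbert-Schmidt norm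
of `M`. In all three cases `exp (t * f)` is a Gram kernel `R Rᵀ` with `R ≥ 0`, by the Gaussian
identity `exp (s ^ 2 / 2) = E exp (s U)`. The Gram property passes to `M` and to its powers. It
gives `⟨1, M ^ ℓ 1⟩ ≤ tr (M ^ ℓ)` and `‖M‖_HS ≤ tr M`, while `⟨1, M 1⟩ ≤ ‖M‖_HS` is Jensen's
inequality. Finiteness of everything reduces to that of `tr M = E exp (t * f A B)`.

The bound for a set of arcs does not go through a decomposition into paths and cycles. Since `π` and
`πstar` are injective, a vertex of the digraph is the tail of at most one arc and the head of at
most one arc. Finner's inequality with exponent `1` on self-loops and `1 / 2` on the squares of the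
other factors bounds the expectation by one factor `tr M` per self-loop and one factor `‖M‖_HS` per
other arc (`lintegral_pi_prod_kernel_le`). Applied to a single cycle it also yields `tr (M ^ ℓ) ≤
‖M‖_HS ^ ℓ`. -/

noncomputable section

namespace CorrelatedGraphs

open scoped ENNReal

/-! ### Product measures and Finner's inequality -/

section ProductIntegrals

variable {I N X Y : Type*} [MeasurableSpace X] [MeasurableSpace Y]

/-- Pulling back a product measure with equal factors along an injection of the index sets. -/
lemma map_pi_comp_injective [Fintype I] [Fintype N] (m : Measure X) [IsProbabilityMeasure m]
    {a : I → N} (ha : Function.Injective a) :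
    (Measure.pi fun _ : N => m).map (fun x i => x (a i)) = Measure.pi fun _ : I => m := by
  have h := (iIndepFun_pi (μ := fun _ : N => m) (X := fun _ x => x)
    fun _ => aemeasurable_id).precomp ha
  rw [iIndepFun_iff_map_fun_eq_pi_map fun i => (measurable_pi_apply _).aemeasurable] at h
  rw [h]
  congr 1
  ext1 i
  exact (measurePreserving_eval (fun _ : N => m) (a i)).map_eq

lemma lintegral_pi_comp_injective [Fintype I] [Fintype N] (m : Measure X) [IsProbabilityMeasure m]
    {a : I → N} (ha : Function.Injective a) {F : (I → X) → ℝ≥0∞} (hF : Measurable F) :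
    ∫⁻ x, F (fun i => x (a i)) ∂(Measure.pi fun _ : N => m) =
      ∫⁻ y, F y ∂(Measure.pi fun _ : I => m) := by
  rw [← map_pi_comp_injective m ha, lintegral_map hF (by fun_prop)]

lemma lintegral_pi_prod [Fintype I] (m : Measure X) [IsProbabilityMeasure m]
    {F : I → X → ℝ≥0∞} (hF : ∀ i, Measurable (F i)) :
    ∫⁻ x, ∏ i, F i (x i) ∂(Measure.pi fun _ : I => m) = ∏ i, ∫⁻ y, F i y ∂m := by
  rw [lintegral_prod_eq_prod_lintegral_of_indepFun Finset.univ (fun i (x : I → X) => F i (x i))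
    (iIndepFun_pi (μ := fun _ : I => m) fun i => (hF i).aemeasurable) fun i => by fun_prop]
  refine Finset.prod_congr rfl fun i _ => ?_
  exact (measurePreserving_eval (fun _ : I => m) i).lintegral_comp (hF i)

lemma lintegral_pi_arrowProd [Fintype N] (m : Measure X) [IsProbabilityMeasure m]
    (k : Measure Y) [IsProbabilityMeasure k] {F : (N → X) → (N → Y) → ℝ≥0∞}
    (hF : Measurable fun q : (N → X) × (N → Y) => F q.1 q.2) :
    ∫⁻ w, F (fun n => (w n).1) (fun n => (w n).2) ∂(Measure.pi fun _ : N => m.prod k) =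
      ∫⁻ x, ∫⁻ y, F x y ∂(Measure.pi fun _ : N => k) ∂(Measure.pi fun _ : N => m) := by
  rw [lintegral_lintegral (f := F) hF.aemeasurable,
    ← (measurePreserving_arrowProdEquivProdArrow X Y N (fun _ => m) fun _ => k).lintegral_comp hF]
  rfl

/-- Finner's inequality: a generalization of Hölder's inequality to products of functions, each of
which depends on some of the coordinates of a product probability space. -/
theorem lintegral_pi_prod_rpow_le [Fintype N] (m : Measure X) [IsProbabilityMeasure m]
    (s : Finset I) {F : I → (N → X) → ℝ≥0∞} (hF : ∀ i, Measurable (F i)) {p : I → ℝ}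
    (hp : ∀ i, 0 ≤ p i) (T : I → Set N) [∀ v i, Decidable (v ∈ T i)]
    (hT : ∀ i, DependsOn (F i) (T i)) (hsum : ∀ v, ∑ i ∈ s with v ∈ T i, p i ≤ 1) :
    ∫⁻ x, ∏ i ∈ s, F i x ^ p i ∂(Measure.pi fun _ : N => m) ≤
      ∏ i ∈ s, (∫⁻ x, F i x ∂(Measure.pi fun _ : N => m)) ^ p i := by
  classical
  -- Coordinates are integrated out one at a time, with Hölder's inequality at each coordinate; `t`
  -- is the set of those already integrated.
  have key : ∀ (t : Finset N) (x : N → X),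
      lmarginal (fun _ => m) t (fun x => ∏ i ∈ s, F i x ^ p i) x ≤
        ∏ i ∈ s, lmarginal (fun _ => m) t (F i) x ^ p i := by
    intro t
    induction t using Finset.induction with
    | empty => intro x; simp
    | insert v t hv ih =>
      intro x
      have hG : ∀ i, Measurable fun y => lmarginal (fun _ => m) t (F i) (Function.update x v y) :=
        fun i => ((hF i).lmarginal _).comp (measurable_update x)
      -- A factor that ignores `v` is unchanged by integrating `v` against a probability measure, so
      -- it can be pulled out of the integral in `y`.
      have hconst : ∀ i, v ∉ T i → ∀ y, lmarginal (fun _ => m) t (F i) (Function.update x v y) =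
          lmarginal (fun _ => m) (insert v t) (F i) x := by
        intro i hi
        have h1 : ∀ y, lmarginal (fun _ => m) t (F i) (Function.update x v y) =
            lmarginal (fun _ => m) t (F i) x := by
          intro y
          rw [lmarginal_update_of_notMem (hF i) hv]
          congr 1
          ext z
          refine hT i fun n hn => ?_
          change Function.update z v y n = z n
          rw [Function.update_of_ne]
          rintro rfl
          exact hi hn
        intro y
        rw [lmarginal_insert _ (hF i) hv]
        simp [h1]
      rw [lmarginal_insert _ (by fun_prop) hv]
      calc _ ≤ ∫⁻ y, ∏ i ∈ s, lmarginal (fun _ => m) t (F i) (Function.update x v y) ^ p i ∂m :=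
            lintegral_mono fun y => ih _
        _ = ∫⁻ y, (∏ i ∈ s with v ∉ T i, lmarginal (fun _ => m) (insert v t) (F i) x ^ p i) *
              ∏ i ∈ s with v ∈ T i,
                lmarginal (fun _ => m) t (F i) (Function.update x v y) ^ p i ∂m := by
            refine lintegral_congr fun y => ?_
            rw [← Finset.prod_filter_not_mul_prod_filter s (fun i => v ∈ T i)]
            congr 1
            refine Finset.prod_congr rfl fun i hi => ?_
            rw [hconst i (Finset.mem_filter.1 hi).2]
        -- Hölder's inequality requires exponents with sum exactly one; the constant function `1`
        -- takes up the slack.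
        _ = (∏ i ∈ s with v ∉ T i, lmarginal (fun _ => m) (insert v t) (F i) x ^ p i) *
              ∫⁻ y, 1 ^ (1 - ∑ i ∈ s with v ∈ T i, p i) * ∏ i ∈ s with v ∈ T i,
                lmarginal (fun _ => m) t (F i) (Function.update x v y) ^ p i ∂m := by
            rw [lintegral_const_mul]
            · simp
            · exact Finset.measurable_prod _ fun i _ => (hG i).pow_const _
        _ ≤ (∏ i ∈ s with v ∉ T i, lmarginal (fun _ => m) (insert v t) (F i) x ^ p i) *
              ((∫⁻ _, 1 ∂m) ^ (1 - ∑ i ∈ s with v ∈ T i, p i) * ∏ i ∈ s with v ∈ T i,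
                (∫⁻ y, lmarginal (fun _ => m) t (F i) (Function.update x v y) ∂m) ^ p i) := by
            gcongr
            refine ENNReal.lintegral_mul_prod_norm_pow_le _ aemeasurable_const
              (fun i _ => (hG i).aemeasurable) _ (by ring) ?_ fun i _ => hp i
            linarith [hsum v]
        _ = ∏ i ∈ s, lmarginal (fun _ => m) (insert v t) (F i) x ^ p i := by
            rw [← Finset.prod_filter_not_mul_prod_filter s (fun i => v ∈ T i)]
            simp only [lintegral_one, measure_univ, ENNReal.one_rpow, one_mul]
            congr 1
            refine Finset.prod_congr rfl fun i _ => ?_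
            rw [lmarginal_insert _ (hF i) hv]
  have : Nonempty X := by
    by_contra h
    rw [not_nonempty_iff] at h
    exact IsProbabilityMeasure.ne_zero m (Measure.eq_zero_of_isEmpty m)
  have h := key Finset.univ (fun _ => Classical.arbitrary X)
  simpa only [lmarginal_univ] using h

end ProductIntegrals

/-! ### Averaging over the noise, given the latent variables -/

section LatentVariables

variable {I N Z : Type*} [MeasurableSpace Z]

/-- The law of a pair of real random variables that are conditionally independent and identically
distributed given a latent variable `x` with law `m`. -/
def latentLaw (m : Measure ℝ) (ζ : Measure Z) (Φ : ℝ → Z → ℝ) : Measure (ℝ × ℝ) :=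
  (m.prod (ζ.prod ζ)).map fun q => (Φ q.1 q.2.1, Φ q.1 q.2.2)

/-- The conditional expectation of `h (A, B')` given the latent variables of two independent
pairs `(A, B)` and `(A', B')`. -/
def latentKernel (ζ : Measure Z) (Φ : ℝ → Z → ℝ) (h : ℝ → ℝ → ℝ≥0∞) (x y : ℝ) : ℝ≥0∞ :=
  ∫⁻ q, h (Φ x q.1) (Φ y q.2) ∂(ζ.prod ζ)

variable {m : Measure ℝ} [IsProbabilityMeasure m] {ζ : Measure Z} [IsProbabilityMeasure ζ]
  {Φ : ℝ → Z → ℝ} {h : ℝ → ℝ → ℝ≥0∞}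

lemma measurable_latentKernel (hΦ : Measurable fun q : ℝ × Z => Φ q.1 q.2)
    (hh : Measurable fun q : ℝ × ℝ => h q.1 q.2) :
    Measurable fun q : ℝ × ℝ => latentKernel ζ Φ h q.1 q.2 := by
  unfold latentKernel
  refine Measurable.lintegral_prod_right' (f := fun r : (ℝ × ℝ) × (Z × Z) =>
    h (Φ r.1.1 r.2.1) (Φ r.1.2 r.2.2)) ?_
  exact hh.comp ((hΦ.comp (by fun_prop : Measurable fun r : (ℝ × ℝ) × (Z × Z) =>
    (r.1.1, r.2.1))).prodMk (hΦ.comp (by fun_prop : Measurable fun r : (ℝ × ℝ) × (Z × Z) =>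
    (r.1.2, r.2.2))))

/-- Each vertex has one noise variable for its `A`-weight and another for its `B`-weight. As `a` and
`b` are injective, each of these enters at most one factor, so that the factors are independent
given the latent variables. -/
lemma lintegral_pi_latentLaw [Fintype I] [Fintype N]
    (hΦ : Measurable fun q : ℝ × Z => Φ q.1 q.2) (hh : Measurable fun q : ℝ × ℝ => h q.1 q.2)
    {a b : I → N} (ha : Function.Injective a) (hb : Function.Injective b) :
    ∫⁻ w, ∏ i, h (w (a i)).1 (w (b i)).2 ∂(Measure.pi fun _ : N => latentLaw m ζ Φ) =
      ∫⁻ x, ∏ i, latentKernel ζ Φ h (x (a i)) (x (b i)) ∂(Measure.pi fun _ : N => m) := by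
  have hΨ : Measurable fun q : ℝ × (Z × Z) => (Φ q.1 q.2.1, Φ q.1 q.2.2) :=
    (hΦ.comp (by fun_prop : Measurable fun q : ℝ × (Z × Z) => (q.1, q.2.1))).prodMk
      (hΦ.comp (by fun_prop : Measurable fun q : ℝ × (Z × Z) => (q.1, q.2.2)))
  have hprob : IsProbabilityMeasure (latentLaw m ζ Φ) :=
    Measure.isProbabilityMeasure_map hΨ.aemeasurable
  have hmeas : ∀ c d : N, Measurable fun r : (N → ℝ) × (N → Z × Z) =>
      h (Φ (r.1 c) (r.2 c).1) (Φ (r.1 d) (r.2 d).2) := fun c d =>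
    hh.comp ((hΦ.comp (by fun_prop : Measurable fun r : (N → ℝ) × (N → Z × Z) =>
      (r.1 c, (r.2 c).1))).prodMk (hΦ.comp (by fun_prop :
      Measurable fun r : (N → ℝ) × (N → Z × Z) => (r.1 d, (r.2 d).2))))
  have hmeas' : ∀ x y : ℝ, Measurable fun r : Z × Z => h (Φ x r.1) (Φ y r.2) := fun x y =>
    hh.comp ((hΦ.comp (by fun_prop : Measurable fun r : Z × Z => (x, r.1))).prodMk
      (hΦ.comp (by fun_prop : Measurable fun r : Z × Z => (y, r.2))))
  have hpi : (Measure.pi fun _ : N => latentLaw m ζ Φ) =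
      (Measure.pi fun _ : N => m.prod (ζ.prod ζ)).map
        fun ω n => (Φ (ω n).1 (ω n).2.1, Φ (ω n).1 (ω n).2.2) := by
    have : ∀ _ : N, SigmaFinite ((m.prod (ζ.prod ζ)).map
        fun q => (Φ q.1 q.2.1, Φ q.1 q.2.2)) := fun _ => by
      change SigmaFinite (latentLaw m ζ Φ); infer_instance
    exact (Measure.pi_map_pi (μ := fun _ : N => m.prod (ζ.prod ζ))
      (f := fun _ q => (Φ q.1 q.2.1, Φ q.1 q.2.2)) fun _ => hΨ.aemeasurable).symm
  rw [hpi, lintegral_map]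
  rotate_left
  · exact Finset.measurable_fun_prod _ fun i _ => hh.comp
      (by fun_prop : Measurable fun w : N → ℝ × ℝ => ((w (a i)).1, (w (b i)).2))
  · exact measurable_pi_lambda _ fun n => hΨ.comp (measurable_pi_apply n)
  have h1 := lintegral_pi_arrowProd (N := N) m (ζ.prod ζ)
    (F := fun x y => ∏ i, h (Φ (x (a i)) (y (a i)).1) (Φ (x (b i)) (y (b i)).2))
    (Finset.measurable_fun_prod _ fun i _ => hmeas _ _)
  refine h1.trans (lintegral_congr fun x => ?_)
  have h2 := lintegral_pi_arrowProd (N := N) ζ ζ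
    (F := fun z z' => ∏ i, h (Φ (x (a i)) (z (a i))) (Φ (x (b i)) (z' (b i))))
    (Finset.measurable_fun_prod _ fun i _ => (hmeas' _ _).comp (by fun_prop : Measurable
      fun q : (N → Z) × (N → Z) => (q.1 (a i), q.2 (b i))))
  have h3 := lintegral_pi_arrowProd (N := I) ζ ζ
    (F := fun z z' => ∏ i, h (Φ (x (a i)) (z i)) (Φ (x (b i)) (z' i)))
    (Finset.measurable_fun_prod _ fun i _ => (hmeas' _ _).comp (by fun_prop : Measurable
      fun q : (I → Z) × (I → Z) => (q.1 i, q.2 i)))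
  have hm3 : Measurable fun q : (I → Z) × (I → Z) =>
      ∏ i, h (Φ (x (a i)) (q.1 i)) (Φ (x (b i)) (q.2 i)) :=
    Finset.measurable_fun_prod _ fun i _ => (hmeas' _ _).comp (by fun_prop : Measurable
      fun q : (I → Z) × (I → Z) => (q.1 i, q.2 i))
  rw [h2]
  -- Noise indexed by vertices is replaced by noise indexed by factors, first along `b` and then
  -- along `a`.
  calc _ = ∫⁻ z, ∫⁻ z', ∏ i, h (Φ (x (a i)) (z (a i))) (Φ (x (b i)) (z' i))
          ∂(Measure.pi fun _ : I => ζ) ∂(Measure.pi fun _ : N => ζ) := by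
        refine lintegral_congr fun z => ?_
        exact lintegral_pi_comp_injective ζ hb
          (F := fun z' => ∏ i, h (Φ (x (a i)) (z (a i))) (Φ (x (b i)) (z' i)))
          (hm3.comp (by fun_prop : Measurable fun z' : I → Z => ((fun i => z (a i)), z')))
    _ = ∫⁻ z, ∫⁻ z', ∏ i, h (Φ (x (a i)) (z i)) (Φ (x (b i)) (z' i))
          ∂(Measure.pi fun _ : I => ζ) ∂(Measure.pi fun _ : I => ζ) :=
        lintegral_pi_comp_injective ζ ha
          (F := fun z => ∫⁻ z', ∏ i, h (Φ (x (a i)) (z i)) (Φ (x (b i)) (z' i))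
            ∂(Measure.pi fun _ : I => ζ)) hm3.lintegral_prod_right'
    _ = _ := by
        rw [← h3]
        exact lintegral_pi_prod (ζ.prod ζ)
          (F := fun i r => h (Φ (x (a i)) r.1) (Φ (x (b i)) r.2)) fun i => hmeas' _ _

end LatentVariables

/-! ### Cauchy-Schwarz and Jensen for nonnegative functions -/

section Inequalities

variable {X : Type*} [MeasurableSpace X]

lemma sq_lintegral_mul_le (m : Measure X) {f g : X → ℝ≥0∞} (hf : Measurable f)
    (hg : Measurable g) :
    (∫⁻ x, f x * g x ∂m) ^ 2 ≤ (∫⁻ x, f x ^ 2 ∂m) * ∫⁻ x, g x ^ 2 ∂m := by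
  have hs : ∀ c : ℝ≥0∞, (c ^ 2) ^ (1 / 2 : ℝ) = c := fun c => by
    rw [← ENNReal.rpow_natCast, ← ENNReal.rpow_mul]; norm_num
  have hs' : ∀ c : ℝ≥0∞, (c ^ (1 / 2 : ℝ)) ^ 2 = c := fun c => by
    rw [← ENNReal.rpow_natCast, ← ENNReal.rpow_mul]; norm_num
  have h := ENNReal.lintegral_mul_norm_pow_le (μ := m) (f := fun x => f x ^ 2)
    (g := fun x => g x ^ 2) (by fun_prop) (by fun_prop) (p := 1 / 2) (q := 1 / 2)
    (by norm_num) (by norm_num) (by norm_num)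
  simp only [hs] at h
  calc _ ≤ ((∫⁻ x, f x ^ 2 ∂m) ^ (1 / 2 : ℝ) * (∫⁻ x, g x ^ 2 ∂m) ^ (1 / 2 : ℝ)) ^ 2 := by
        gcongr
    _ = _ := by rw [mul_pow, hs', hs']

lemma sq_lintegral_le (m : Measure X) [IsProbabilityMeasure m] {f : X → ℝ≥0∞}
    (hf : Measurable f) : (∫⁻ x, f x ∂m) ^ 2 ≤ ∫⁻ x, f x ^ 2 ∂m := by
  simpa using sq_lintegral_mul_le m hf (measurable_const (a := (1 : ℝ≥0∞)))

end Inequalities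

/-! ### Gram kernels, their traces and their powers -/

section Kernels

variable (m : Measure ℝ) (M : ℝ → ℝ → ℝ≥0∞)

/-- The powers `M ^ (n + 1)` of a kernel `M` on a measure space. -/
def kernelPow : ℕ → ℝ → ℝ → ℝ≥0∞
  | 0 => M
  | n + 1 => fun x y => ∫⁻ z, kernelPow n x z * M z y ∂m

/-- The trace of a kernel. -/
def kernelTrace : ℝ≥0∞ := ∫⁻ x, M x x ∂m

/-- The square of the Hilbert-Schmidt norm of a kernel. -/
def kernelSq : ℝ≥0∞ := ∫⁻ x, ∫⁻ y, M x y ^ 2 ∂m ∂m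

/-- A kernel of the form `R Rᵀ` with a nonnegative kernel `R`. -/
def IsGram (M : ℝ → ℝ → ℝ≥0∞) : Prop :=
  ∃ (θ : Measure ℝ) (_ : IsProbabilityMeasure θ) (R : ℝ → ℝ → ℝ≥0∞),
    Measurable (fun q : ℝ × ℝ => R q.1 q.2) ∧ ∀ x y, M x y = ∫⁻ u, R x u * R y u ∂θ

variable {m M}

lemma IsGram.symm (h : IsGram M) (x y : ℝ) : M x y = M y x := by
  obtain ⟨θ, _, R, -, hR⟩ := h
  simp only [hR, mul_comm]

/-- Cauchy-Schwarz for the rows `R x` and `R y` gives `M x y ^ 2 ≤ M x x * M y y`, and the right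
side integrates to the square of the trace. -/
lemma IsGram.kernelSq_le (h : IsGram M) (hM : Measurable fun q : ℝ × ℝ => M q.1 q.2) :
    kernelSq m M ≤ kernelTrace m M ^ 2 := by
  obtain ⟨θ, _, R, hRm, hR⟩ := h
  have hR2 : ∀ x, Measurable fun u => R x u := fun x =>
    hRm.comp (by fun_prop : Measurable (Prod.mk x))
  have hd : Measurable fun x => M x x :=
    hM.comp (by fun_prop : Measurable fun x : ℝ => (x, x))
  have hle : ∀ x y, M x y ^ 2 ≤ M x x * M y y := fun x y => by
    simpa only [hR, sq] using sq_lintegral_mul_le θ (hR2 x) (hR2 y)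
  calc kernelSq m M ≤ ∫⁻ x, ∫⁻ y, M x x * M y y ∂m ∂m :=
        lintegral_mono fun x => lintegral_mono fun y => hle x y
    _ = kernelTrace m M ^ 2 := by
        simp only [lintegral_const_mul _ hd, lintegral_mul_const _ hd, kernelTrace, sq]

variable [IsProbabilityMeasure m]

/-- For `M = R Rᵀ` the left side is `∫ (∫ R x u dm(x)) ^ 2 dθ(u)`. Jensen's inequality in `x` moves
the square inside, which leaves the trace. -/
lemma IsGram.lintegral_le_trace (h : IsGram M) :
    ∫⁻ x, ∫⁻ y, M x y ∂m ∂m ≤ kernelTrace m M := by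
  obtain ⟨θ, _, R, hRm, hR⟩ := h
  have hR1 : ∀ u, Measurable fun x => R x u := fun u =>
      hRm.comp (by fun_prop : Measurable fun x : ℝ => (x, u))
  have hR2 : ∀ x, Measurable fun u => R x u := fun x =>
    hRm.comp (by fun_prop : Measurable (Prod.mk x))
  have hR3 : Measurable fun q : ℝ × ℝ => R q.2 q.1 := hRm.comp measurable_swap
  have hint : Measurable fun u => ∫⁻ x, R x u ∂m := hR3.lintegral_prod_right'
  calc ∫⁻ x, ∫⁻ y, M x y ∂m ∂m
      = ∫⁻ x, ∫⁻ u, R x u * ∫⁻ y, R y u ∂m ∂θ ∂m := by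
        refine lintegral_congr fun x => ?_
        simp only [hR]
        rw [lintegral_lintegral_swap]
        · exact lintegral_congr fun u => lintegral_const_mul _ (hR1 u)
        · exact (((hR2 x).comp measurable_snd).mul hRm).aemeasurable
    _ = ∫⁻ u, ∫⁻ x, R x u * ∫⁻ y, R y u ∂m ∂m ∂θ :=
        lintegral_lintegral_swap (hRm.mul (hint.comp measurable_snd)).aemeasurable
    _ = ∫⁻ u, (∫⁻ x, R x u ∂m) ^ 2 ∂θ := by
        refine lintegral_congr fun u => ?_
        rw [lintegral_mul_const _ (hR1 u), sq]
    _ ≤ ∫⁻ u, ∫⁻ x, R x u ^ 2 ∂m ∂θ := lintegral_mono fun u => sq_lintegral_le m (hR1 u)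
    _ = ∫⁻ x, ∫⁻ u, R x u ^ 2 ∂θ ∂m := lintegral_lintegral_swap (hR3.pow_const 2).aemeasurable
    _ = kernelTrace m M := by simp only [kernelTrace, hR, sq]

lemma sq_lintegral_le_kernelSq (hM : Measurable fun q : ℝ × ℝ => M q.1 q.2) :
    (∫⁻ x, ∫⁻ y, M x y ∂m ∂m) ^ 2 ≤ kernelSq m M :=
  (sq_lintegral_le m hM.lintegral_prod_right').trans
    (lintegral_mono fun x => sq_lintegral_le m (hM.comp (by fun_prop : Measurable (Prod.mk x))))

lemma measurable_kernelPow (hM : Measurable fun q : ℝ × ℝ => M q.1 q.2) (n : ℕ) :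
    Measurable fun q : ℝ × ℝ => kernelPow m M n q.1 q.2 := by
  induction n with
  | zero => exact hM
  | succ n ih =>
    refine Measurable.lintegral_prod_right' (f := fun r : (ℝ × ℝ) × ℝ =>
      kernelPow m M n r.1.1 r.2 * M r.2 r.1.2) ?_
    exact (ih.comp (by fun_prop : Measurable fun r : (ℝ × ℝ) × ℝ => (r.1.1, r.2))).mul
      (hM.comp (by fun_prop : Measurable fun r : (ℝ × ℝ) × ℝ => (r.2, r.1.2)))

/-- Powers are built by multiplication on the right. Multiplication on the left is also needed, to
put a power between two copies of `M`. -/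
lemma kernelPow_succ' (hM : Measurable fun q : ℝ × ℝ => M q.1 q.2) (n : ℕ) (x y : ℝ) :
    kernelPow m M (n + 1) x y = ∫⁻ z, M x z * kernelPow m M n z y ∂m := by
  induction n generalizing y with
  | zero => rfl
  | succ n ih =>
    have hP := measurable_kernelPow (m := m) hM n
    have h1 : ∀ z, Measurable fun w => kernelPow m M n z w := fun z =>
      hP.comp (by fun_prop : Measurable (Prod.mk z))
    have h2 : ∀ z, Measurable fun w => M w z := fun z =>
      hM.comp (by fun_prop : Measurable fun w : ℝ => (w, z))
    have h3 : ∀ z, Measurable fun w => M z w := fun z =>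
      hM.comp (by fun_prop : Measurable (Prod.mk z))
    have h4 : ∀ z, Measurable fun w => kernelPow m M n w z := fun z =>
      hP.comp (by fun_prop : Measurable fun w : ℝ => (w, z))
    calc kernelPow m M (n + 1 + 1) x y
        = ∫⁻ z, (∫⁻ w, M x w * kernelPow m M n w z ∂m) * M z y ∂m :=
          lintegral_congr fun z => by rw [ih]
      _ = ∫⁻ z, ∫⁻ w, M x w * kernelPow m M n w z * M z y ∂m ∂m :=
          lintegral_congr fun z => (lintegral_mul_const _ ((h3 x).mul (h4 z))).symm
      _ = ∫⁻ w, ∫⁻ z, M x w * kernelPow m M n w z * M z y ∂m ∂m := by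
          refine lintegral_lintegral_swap (Measurable.aemeasurable ?_)
          exact (((h3 x).comp measurable_snd).mul
            (hP.comp measurable_swap)).mul ((h2 y).comp measurable_fst)
      _ = ∫⁻ w, M x w * kernelPow m M (n + 1) w y ∂m := by
          refine lintegral_congr fun w => ?_
          simp only [mul_assoc]
          exact lintegral_const_mul _ ((h1 w).mul (h2 y))

/-- By symmetry `M ^ 2 = M Mᵀ`, and `M ^ k = R Rᵀ` implies `M ^ (k + 2) = M (R Rᵀ) M = (M R) (M
R)ᵀ`. Hence an induction in steps of two from `M` and `M ^ 2`. -/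
lemma IsGram.kernelPow (h : IsGram M) (hM : Measurable fun q : ℝ × ℝ => M q.1 q.2) (n : ℕ) :
    IsGram (kernelPow m M n) := by
  induction n using Nat.twoStepInduction with
  | zero => exact h
  | one => exact ⟨m, inferInstance, M, hM, fun x y => lintegral_congr fun z => by
      rw [h.symm z y]; rfl⟩
  | more n ih _ =>
    obtain ⟨θ, _, R, hRm, hR⟩ := ih
    have hP := measurable_kernelPow (m := m) hM n
    have h3 : ∀ z, Measurable fun w => M z w := fun z =>
      hM.comp (by fun_prop : Measurable (Prod.mk z))
    have hR1 : ∀ u, Measurable fun x => R x u := fun u =>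
      hRm.comp (by fun_prop : Measurable fun x : ℝ => (x, u))
    have hR2 : ∀ x, Measurable fun u => R x u := fun x =>
    hRm.comp (by fun_prop : Measurable (Prod.mk x))
    have hS : Measurable fun q : ℝ × ℝ => ∫⁻ z, M q.1 z * R z q.2 ∂m := by
      refine Measurable.lintegral_prod_right' (f := fun r : (ℝ × ℝ) × ℝ =>
        M r.1.1 r.2 * R r.2 r.1.2) ?_
      exact (hM.comp (by fun_prop : Measurable fun r : (ℝ × ℝ) × ℝ => (r.1.1, r.2))).mul
        (hRm.comp (by fun_prop : Measurable fun r : (ℝ × ℝ) × ℝ => (r.2, r.1.2)))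
    have hS2 : ∀ x, Measurable fun u => ∫⁻ z, M x z * R z u ∂m := fun x =>
      hS.comp (by fun_prop : Measurable (Prod.mk x))
    refine ⟨θ, inferInstance, fun x u => ∫⁻ z, M x z * R z u ∂m, hS, fun x y => ?_⟩
    have hstep : ∀ z, CorrelatedGraphs.kernelPow m M (n + 1) z y =
        ∫⁻ u, R z u * ∫⁻ z', M y z' * R z' u ∂m ∂θ := fun z => by
      calc _ = ∫⁻ z', ∫⁻ u, R z u * (M y z' * R z' u) ∂θ ∂m := by
            refine lintegral_congr fun z' => ?_
            rw [hR, h.symm z' y]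
            refine (lintegral_mul_const _ ((hR2 z).mul (hR2 z'))).symm.trans ?_
            exact lintegral_congr fun u => by simp only [Pi.mul_apply]; ring
        _ = ∫⁻ u, ∫⁻ z', R z u * (M y z' * R z' u) ∂m ∂θ := by
            refine lintegral_lintegral_swap (Measurable.aemeasurable ?_)
            exact ((hR2 z).comp measurable_snd).mul (((h3 y).comp measurable_fst).mul hRm)
        _ = _ := lintegral_congr fun u => lintegral_const_mul _ ((h3 y).mul (hR1 u))
    rw [kernelPow_succ' hM]
    calc _ = ∫⁻ z, ∫⁻ u, (M x z * R z u) * ∫⁻ z', M y z' * R z' u ∂m ∂θ ∂m := by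
          refine lintegral_congr fun z => ?_
          rw [hstep]
          refine (lintegral_const_mul _ ((hR2 z).mul (hS2 y))).symm.trans ?_
          simp only [Pi.mul_apply, mul_assoc]
      _ = ∫⁻ u, ∫⁻ z, (M x z * R z u) * ∫⁻ z', M y z' * R z' u ∂m ∂m ∂θ := by
          refine lintegral_lintegral_swap (Measurable.aemeasurable ?_)
          exact (((h3 x).comp measurable_fst).mul hRm).mul ((hS2 y).comp measurable_snd)
      _ = _ := lintegral_congr fun u => lintegral_mul_const _ ((h3 x).mul (hR1 u))

end Kernels

/-! ### Integrals of products of kernels along the arcs of a graph -/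

section Graphs

variable {m : Measure ℝ} [IsProbabilityMeasure m] {M : ℝ → ℝ → ℝ≥0∞}

lemma lintegral_pi_two {F : ℝ → ℝ → ℝ≥0∞} (hF : Measurable fun q : ℝ × ℝ => F q.1 q.2) :
    ∫⁻ x, F (x 0) (x 1) ∂(Measure.pi fun _ : Fin 2 => m) = ∫⁻ x, ∫⁻ y, F x y ∂m ∂m := by
  rw [lintegral_lintegral (f := F) hF.aemeasurable,
    ← (measurePreserving_finTwoArrow m).lintegral_comp hF]
  rfl

lemma lintegral_pi_pair {N : Type*} [Fintype N] {F : ℝ → ℝ → ℝ≥0∞}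
    (hF : Measurable fun q : ℝ × ℝ => F q.1 q.2) {a b : N} (hab : a ≠ b) :
    ∫⁻ x, F (x a) (x b) ∂(Measure.pi fun _ : N => m) = ∫⁻ x, ∫⁻ y, F x y ∂m ∂m := by
  rw [← lintegral_pi_two hF]
  refine lintegral_pi_comp_injective m (a := ![a, b]) ?_ (F := fun x => F (x 0) (x 1))
    (hF.comp (by fun_prop : Measurable fun x : Fin 2 → ℝ => (x 0, x 1)))
  intro i j
  fin_cases i <;> fin_cases j <;> simp [hab, hab.symm]

/-- Finner's inequality for a graph with in- and out-degrees at most one. A loop has exponent `1`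
and any other arc exponent `1 / 2` on the square of its factor, so each end of an arc charges `1 /
2` to its vertex and no vertex is charged more than `1`. -/
lemma lintegral_pi_prod_kernel_le {I N : Type*} [Fintype I] [Fintype N] [DecidableEq N]
    (hM : Measurable fun q : ℝ × ℝ => M q.1 q.2) {a b : I → N} (ha : Function.Injective a)
    (hb : Function.Injective b) :
    ∫⁻ x, ∏ i, M (x (a i)) (x (b i)) ∂(Measure.pi fun _ : N => m) ≤
      ∏ i, if a i = b i then kernelTrace m M else kernelSq m M ^ (1 / 2 : ℝ) := by
  classical
  have hMab : ∀ c d : N, Measurable fun x : N → ℝ => M (x c) (x d) := fun c d =>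
    hM.comp (by fun_prop : Measurable fun x : N → ℝ => (x c, x d))
  have key := lintegral_pi_prod_rpow_le m Finset.univ
    (F := fun i x => if a i = b i then M (x (a i)) (x (b i)) else M (x (a i)) (x (b i)) ^ 2)
    (fun i => by split_ifs; exacts [hMab _ _, (hMab _ _).pow_const 2])
    (p := fun i => if a i = b i then 1 else 1 / 2) (fun i => by split_ifs <;> norm_num)
    (fun i => {a i, b i})
    (fun i x y hxy => by simp only [hxy (a i) (by simp), hxy (b i) (by simp)])
    (fun v => by
      have hcount : ∀ c : I → N, Function.Injective c →
          ∑ i, (if c i = v then (1 / 2 : ℝ) else 0) ≤ 1 / 2 := fun c hc => by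
        rw [← Finset.sum_filter, Finset.sum_const, nsmul_eq_mul]
        have : (Finset.univ.filter fun i => c i = v).card ≤ 1 :=
          Finset.card_le_one.2 fun i hi j hj =>
            hc ((Finset.mem_filter.1 hi).2.trans (Finset.mem_filter.1 hj).2.symm)
        have : ((Finset.univ.filter fun i => c i = v).card : ℝ) ≤ 1 := by exact_mod_cast this
        linarith
      have h1 := hcount a ha
      have h2 := hcount b hb
      rw [Finset.sum_filter]
      -- A loop at `v` counts once as a tail and once as a head, which accounts for its full
      -- exponent `1`.
      calc _ ≤ ∑ i, ((if a i = v then (1 / 2 : ℝ) else 0) + if b i = v then (1 / 2 : ℝ) else 0) := by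
            refine Finset.sum_le_sum fun i _ => ?_
            by_cases h : a i = b i
            · by_cases h' : b i = v
              · simp [h, h']; norm_num
              · simp [h, h', Ne.symm h']
            · by_cases h' : a i = v
              · subst h'; simp [h, Ne.symm h]
              · by_cases h'' : b i = v
                · subst h''; simp [h]
                · simp [h', h'', Ne.symm h', Ne.symm h'']
        _ ≤ 1 := by rw [Finset.sum_add_distrib]; linarith)
  have hs : ∀ c : ℝ≥0∞, (c ^ 2) ^ (1 / 2 : ℝ) = c := fun c => by
    rw [← ENNReal.rpow_natCast, ← ENNReal.rpow_mul]; norm_num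
  refine (le_of_eq ?_).trans (key.trans (le_of_eq ?_))
  · refine lintegral_congr fun x => Finset.prod_congr rfl fun i _ => ?_
    split_ifs
    · simp
    · rw [hs]
  · refine Finset.prod_congr rfl fun i _ => ?_
    split_ifs with h
    · rw [ENNReal.rpow_one]
      simp only [h]
      exact (measurePreserving_eval (fun _ : N => m) (b i)).lintegral_comp
        (f := fun x => M x x) (hM.comp (by fun_prop : Measurable fun x : ℝ => (x, x)))
    · rw [lintegral_pi_pair (F := fun x y => M x y ^ 2) (hM.pow_const 2) h]
      rfl

/-- The weight `G` on the two end points lets one induction serve both shapes: `G = 1` gives paths,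
and `G x y = M y x` closes the chain to a cycle. It also makes the induction work, since integrating
out the last vertex merely changes `G`. -/
lemma lintegral_pi_chain (hM : Measurable fun q : ℝ × ℝ => M q.1 q.2) (n : ℕ)
    {G : ℝ → ℝ → ℝ≥0∞} (hG : Measurable fun q : ℝ × ℝ => G q.1 q.2) :
    ∫⁻ x, (∏ i : Fin (n + 1), M (x i.castSucc) (x i.succ)) * G (x 0) (x (Fin.last _))
        ∂(Measure.pi fun _ : Fin (n + 2) => m) =
      ∫⁻ x, ∫⁻ y, kernelPow m M n x y * G x y ∂m ∂m := by
  induction n generalizing G with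
  | zero =>
    rw [← lintegral_pi_two (F := fun x y => kernelPow m M 0 x y * G x y)
      ((measurable_kernelPow hM 0).mul hG)]
    refine lintegral_congr fun x => ?_
    simp [kernelPow]
  | succ n ih =>
    have hP := measurable_kernelPow (m := m) hM n
    have hG' : Measurable fun q : ℝ × ℝ => ∫⁻ z, M q.2 z * G q.1 z ∂m := by
      refine Measurable.lintegral_prod_right' (f := fun r : (ℝ × ℝ) × ℝ =>
        M r.1.2 r.2 * G r.1.1 r.2) ?_
      exact (hM.comp (by fun_prop : Measurable fun r : (ℝ × ℝ) × ℝ => (r.1.2, r.2))).mul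
        (hG.comp (by fun_prop : Measurable fun r : (ℝ × ℝ) × ℝ => (r.1.1, r.2)))
    have hcoord : ∀ (F : ℝ → ℝ → ℝ≥0∞), (Measurable fun q : ℝ × ℝ => F q.1 q.2) →
        ∀ k (c d : Fin k), Measurable fun x : Fin k → ℝ => F (x c) (x d) := fun F hF k c d =>
      hF.comp (by fun_prop : Measurable fun x : Fin k → ℝ => (x c, x d))
    have hmeas : Measurable fun x : Fin (n + 1 + 2) → ℝ =>
        (∏ i : Fin (n + 1 + 1), M (x i.castSucc) (x i.succ)) * G (x 0) (x (Fin.last _)) :=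
      (Finset.measurable_fun_prod _ fun i _ => hcoord M hM _ _ _).mul (hcoord G hG _ _ _)
    have hsplit := (measurePreserving_piFinSuccAbove (fun _ : Fin (n + 1 + 2) => m)
      (Fin.last _)).symm
    rw [← hsplit.lintegral_comp hmeas]
    refine (lintegral_prod_symm' _ (hmeas.comp hsplit.measurable)).trans ?_
    have hinner : ∀ y : Fin (n + 2) → ℝ,
        ∫⁻ z, (∏ i : Fin (n + 1 + 1),
            M ((MeasurableEquiv.piFinSuccAbove (fun _ : Fin (n + 1 + 2) => ℝ)
                (Fin.last _)).symm (z, y) i.castSucc)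
              ((MeasurableEquiv.piFinSuccAbove (fun _ : Fin (n + 1 + 2) => ℝ)
                (Fin.last _)).symm (z, y) i.succ)) *
            G ((MeasurableEquiv.piFinSuccAbove (fun _ : Fin (n + 1 + 2) => ℝ)
                (Fin.last _)).symm (z, y) 0)
              ((MeasurableEquiv.piFinSuccAbove (fun _ : Fin (n + 1 + 2) => ℝ)
                (Fin.last _)).symm (z, y) (Fin.last _)) ∂m =
          (∏ i : Fin (n + 1), M (y i.castSucc) (y i.succ)) *
            ∫⁻ z, M (y (Fin.last _)) z * G (y 0) z ∂m := by
      intro y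
      rw [← lintegral_const_mul]
      · refine lintegral_congr fun z => ?_
        have hlast : (MeasurableEquiv.piFinSuccAbove (fun _ : Fin (n + 1 + 2) => ℝ)
            (Fin.last _)).symm (z, y) (Fin.last _) = z := by
          simp [MeasurableEquiv.piFinSuccAbove]
        have hcast : ∀ i, (MeasurableEquiv.piFinSuccAbove (fun _ : Fin (n + 1 + 2) => ℝ)
            (Fin.last _)).symm (z, y) (Fin.castSucc i) = y i := fun i => by
          simp [MeasurableEquiv.piFinSuccAbove]
        rw [Fin.prod_univ_castSucc]
        simp only [Fin.succ_castSucc, Fin.succ_last, hcast, hlast, ← Fin.castSucc_zero]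
        ring
      · exact (hM.comp (by fun_prop : Measurable (Prod.mk (y (Fin.last _))))).mul
          (hG.comp (by fun_prop : Measurable (Prod.mk (y 0))))
    refine (lintegral_congr hinner).trans ((ih (G := fun x y => ∫⁻ z, M y z * G x z ∂m) hG').trans ?_)
    refine lintegral_congr fun x => ?_
    have h1 : ∀ z, Measurable fun w => kernelPow m M n z w := fun z =>
      hP.comp (by fun_prop : Measurable (Prod.mk z))
    have h2 : ∀ z, Measurable fun w => M w z := fun z =>
      hM.comp (by fun_prop : Measurable fun w : ℝ => (w, z))
    have h3 : ∀ z, Measurable fun w => M z w := fun z =>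
      hM.comp (by fun_prop : Measurable (Prod.mk z))
    have h4 : ∀ z, Measurable fun w => G z w := fun z =>
      hG.comp (by fun_prop : Measurable (Prod.mk z))
    -- Tonelli's theorem takes the last factor `M y z` from the modified weight back into the kernel
    -- power.
    calc _ = ∫⁻ y, ∫⁻ z, kernelPow m M n x y * (M y z * G x z) ∂m ∂m :=
          lintegral_congr fun y => (lintegral_const_mul _ ((h3 y).mul (h4 x))).symm
      _ = ∫⁻ z, ∫⁻ y, kernelPow m M n x y * (M y z * G x z) ∂m ∂m := by
          refine lintegral_lintegral_swap (Measurable.aemeasurable ?_)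
          exact ((h1 x).comp measurable_fst).mul (hM.mul ((h4 x).comp measurable_snd))
      _ = _ := by
          refine lintegral_congr fun z => ?_
          simp only [← mul_assoc]
          exact lintegral_mul_const _ ((h1 x).mul (h2 z))

lemma lintegral_pi_path (hM : Measurable fun q : ℝ × ℝ => M q.1 q.2) (n : ℕ) :
    ∫⁻ x, ∏ i : Fin (n + 1), M (x i.castSucc) (x i.succ)
        ∂(Measure.pi fun _ : Fin (n + 2) => m) =
      ∫⁻ x, ∫⁻ y, kernelPow m M n x y ∂m ∂m := by
  simpa using lintegral_pi_chain (m := m) hM n (G := fun _ _ => 1) measurable_const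

lemma lintegral_pi_cycle (hM : Measurable fun q : ℝ × ℝ => M q.1 q.2) (n : ℕ) :
    ∫⁻ x, ∏ i : Fin (n + 1), M (x i) (x (finRotate _ i))
        ∂(Measure.pi fun _ : Fin (n + 1) => m) = kernelTrace m (kernelPow m M n) := by
  cases n with
  | zero =>
    refine Eq.trans (lintegral_congr fun x => ?_)
      ((measurePreserving_eval (fun _ : Fin 1 => m) 0).lintegral_comp
        (f := fun x => M x x) (hM.comp (by fun_prop : Measurable fun x : ℝ => (x, x))))
    simp
  | succ n =>
    have h := lintegral_pi_chain (m := m) hM n (G := fun x y => M y x)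
      (hM.comp measurable_swap)
    refine Eq.trans (lintegral_congr fun x => ?_) h
    rw [Fin.prod_univ_castSucc]
    simp [finRotate_apply]

end Graphs

/-! ### The kernel on the latent variables -/

section LatentGram

variable {Z : Type*} [MeasurableSpace Z] {m : Measure ℝ}
  {ζ : Measure Z} [IsProbabilityMeasure ζ] {Φ : ℝ → Z → ℝ} {h : ℝ → ℝ → ℝ≥0∞}

lemma measurable_latent_pair (hΦ : Measurable fun q : ℝ × Z => Φ q.1 q.2) :
    Measurable fun q : ℝ × (Z × Z) => (Φ q.1 q.2.1, Φ q.1 q.2.2) :=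
  (hΦ.comp (by fun_prop : Measurable fun q : ℝ × (Z × Z) => (q.1, q.2.1))).prodMk
    (hΦ.comp (by fun_prop : Measurable fun q : ℝ × (Z × Z) => (q.1, q.2.2)))

lemma lintegral_latentLaw (hΦ : Measurable fun q : ℝ × Z => Φ q.1 q.2) {F : ℝ × ℝ → ℝ≥0∞}
    (hF : Measurable F) :
    ∫⁻ w, F w ∂(latentLaw m ζ Φ) = ∫⁻ x, ∫⁻ z, ∫⁻ z', F (Φ x z, Φ x z') ∂ζ ∂ζ ∂m := by
  have hΨ := hF.comp (measurable_latent_pair hΦ)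
  rw [latentLaw, lintegral_map hF (measurable_latent_pair hΦ)]
  refine (lintegral_prod _ hΨ.aemeasurable).trans (lintegral_congr fun x => ?_)
  exact lintegral_prod _ (hΨ.comp (by fun_prop : Measurable (Prod.mk x))).aemeasurable

/-- On the diagonal both weights share one latent value, so they are distributed as the two members
of one correlated pair. -/
lemma kernelTrace_latentKernel (hΦ : Measurable fun q : ℝ × Z => Φ q.1 q.2)
    (hh : Measurable fun q : ℝ × ℝ => h q.1 q.2) :
    kernelTrace m (latentKernel ζ Φ h) = ∫⁻ w, h w.1 w.2 ∂(latentLaw m ζ Φ) := by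
  rw [latentLaw, lintegral_map hh (measurable_latent_pair hΦ)]
  exact (lintegral_prod _ (hh.comp (measurable_latent_pair hΦ)).aemeasurable).symm

/-- The noises of the two weights are independent and have the same law, so averaging acts on each
of the two factors `R` separately and in the same way. -/
lemma IsGram.latentKernel (hh : IsGram h) (hΦ : Measurable fun q : ℝ × Z => Φ q.1 q.2) :
    IsGram (latentKernel ζ Φ h) := by
  obtain ⟨θ, _, R, hRm, hR⟩ := hh
  have hΦ' : ∀ x, Measurable (Φ x) := fun x => hΦ.comp (by fun_prop : Measurable (Prod.mk x))
  have hR1 : ∀ x u, Measurable fun z => R (Φ x z) u := fun x u =>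
    hRm.comp ((hΦ' x).prodMk measurable_const)
  refine ⟨θ, inferInstance, fun x u => ∫⁻ z, R (Φ x z) u ∂ζ, ?_, fun x y => ?_⟩
  · refine Measurable.lintegral_prod_right' (f := fun r : (ℝ × ℝ) × Z => R (Φ r.1.1 r.2) r.1.2) ?_
    exact hRm.comp ((hΦ.comp (by fun_prop : Measurable fun r : (ℝ × ℝ) × Z =>
      (r.1.1, r.2))).prodMk (by fun_prop : Measurable fun r : (ℝ × ℝ) × Z => r.1.2))
  · calc _ = ∫⁻ q : Z × Z, ∫⁻ u, R (Φ x q.1) u * R (Φ y q.2) u ∂θ ∂(ζ.prod ζ) := by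
          simp only [CorrelatedGraphs.latentKernel, hR]
      _ = ∫⁻ u, ∫⁻ q : Z × Z, R (Φ x q.1) u * R (Φ y q.2) u ∂(ζ.prod ζ) ∂θ := by
          refine lintegral_lintegral_swap (Measurable.aemeasurable ?_)
          exact (hRm.comp (((hΦ' x).comp (by fun_prop : Measurable fun r : (Z × Z) × ℝ =>
            r.1.1)).prodMk measurable_snd)).mul (hRm.comp (((hΦ' y).comp (by fun_prop :
            Measurable fun r : (Z × Z) × ℝ => r.1.2)).prodMk measurable_snd))
      _ = _ := lintegral_congr fun u =>
          lintegral_prod_mul (hR1 x u).aemeasurable (hR1 y u).aemeasurable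

end LatentGram

/-! ### The exponentials of the scores are Gram kernels -/

section Scores

lemma lintegral_exp_mul_gaussianReal (s : ℝ) :
    ∫⁻ u, ENNReal.ofReal (Real.exp (s * u)) ∂(gaussianReal 0 1) =
      ENNReal.ofReal (Real.exp (s ^ 2 / 2)) := by
  rw [← ofReal_integral_eq_lintegral_ofReal (integrable_exp_mul_gaussianReal s)
    (Filter.Eventually.of_forall fun u => (Real.exp_pos _).le)]
  have h := congrFun (mgf_id_gaussianReal (μ := 0) (v := 1)) s
  simp only [mgf, id] at h
  rw [h]
  simp

/-- The Gaussian identity with `s = √t * (a + b)` produces `t * a * b` together with `t / 2 * (a ^ 2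
+ b ^ 2)`; the factors remove the squares. Both scores are covered: `c = 0` is the product and `c =
t / 2` the squared difference. -/
lemma isGram_exp_quadratic {t : ℝ} (ht : 0 ≤ t) (c : ℝ) :
    IsGram fun a b => ENNReal.ofReal (Real.exp (t * (a * b) - c * a ^ 2 - c * b ^ 2)) := by
  refine ⟨gaussianReal 0 1, inferInstance,
    fun a u => ENNReal.ofReal (Real.exp (√t * a * u - (t / 2 + c) * a ^ 2)), by fun_prop,
    fun a b => ?_⟩
  have h : ∀ u, ENNReal.ofReal (Real.exp (√t * a * u - (t / 2 + c) * a ^ 2)) *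
      ENNReal.ofReal (Real.exp (√t * b * u - (t / 2 + c) * b ^ 2)) =
      ENNReal.ofReal (Real.exp (-((t / 2 + c) * (a ^ 2 + b ^ 2)))) *
        ENNReal.ofReal (Real.exp (√t * (a + b) * u)) := fun u => by
    rw [← ENNReal.ofReal_mul (Real.exp_pos _).le, ← ENNReal.ofReal_mul (Real.exp_pos _).le,
      ← Real.exp_add, ← Real.exp_add]
    congr 2
    ring
  simp only [h]
  rw [lintegral_const_mul _ (by fun_prop), lintegral_exp_mul_gaussianReal,
    ← ENNReal.ofReal_mul (Real.exp_pos _).le, ← Real.exp_add, mul_pow, Real.sq_sqrt ht]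
  congr 2
  ring

lemma isGram_exp_mul {t : ℝ} (ht : 0 ≤ t) :
    IsGram fun a b => ENNReal.ofReal (Real.exp (t * (a * b))) := by
  simpa using isGram_exp_quadratic ht 0

lemma isGram_exp_sq_sub {t : ℝ} (ht : 0 ≤ t) :
    IsGram fun a b => ENNReal.ofReal (Real.exp (t * (-(1 / 2) * (a - b) ^ 2))) := by
  convert isGram_exp_quadratic ht (t / 2) using 5
  ring

end Scores

/-! ### The bivariate Bernoulli law as a mixture -/

section Bernoulli

variable {p ρ : ℝ}

lemma isProbabilityMeasure_bernoulliLaw (hp₀ : 0 ≤ p) (hp₁ : p ≤ 1) :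
    IsProbabilityMeasure (bernoulliLaw p) := by
  constructor
  simp only [bernoulliLaw, Measure.coe_add, Measure.coe_smul, Pi.add_apply, Pi.smul_apply,
    measure_univ, smul_eq_mul, mul_one]
  rw [← ENNReal.ofReal_add hp₀ (by linarith)]
  simp

lemma lintegral_bernoulliLaw (p : ℝ) (F : ℝ → ℝ≥0∞) :
    ∫⁻ x, F x ∂(bernoulliLaw p) = ENNReal.ofReal p * F 1 + ENNReal.ofReal (1 - p) * F 0 := by
  simp [bernoulliLaw]

lemma lintegral_bivariateBernoulliLaw (p ρ : ℝ) (F : ℝ × ℝ → ℝ≥0∞) :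
    ∫⁻ w, F w ∂(bivariateBernoulliLaw p ρ) =
      ENNReal.ofReal (p ^ 2 + ρ * p * (1 - p)) * F (1, 1)
        + ENNReal.ofReal ((1 - ρ) * p * (1 - p)) * F (1, 0)
        + ENNReal.ofReal ((1 - ρ) * p * (1 - p)) * F (0, 1)
        + ENNReal.ofReal ((1 - p) ^ 2 + ρ * p * (1 - p)) * F (0, 0) := by
  simp [bivariateBernoulliLaw]

/-- A pair of correlated Bernoulli variables arises from a common Bernoulli variable, each member
of the pair being an independent copy of it unless an independent coin of bias `√ρ` succeeds. -/
lemma bivariateBernoulliLaw_eq_latentLaw (hp₀ : 0 ≤ p) (hp₁ : p ≤ 1) (hρ₀ : 0 ≤ ρ)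
    (hρ₁ : ρ ≤ 1) :
    bivariateBernoulliLaw p ρ = latentLaw (bernoulliLaw p)
      ((bernoulliLaw √ρ).prod (bernoulliLaw p)) fun x z => z.1 * x + (1 - z.1) * z.2 := by
  -- With `ρ = r ^ 2` the probabilities become polynomials in `p` and `r`.
  obtain ⟨r, hr, hr₀, hr₁⟩ : ∃ r, r = √ρ ∧ 0 ≤ r ∧ r ≤ 1 :=
    ⟨_, rfl, Real.sqrt_nonneg _, Real.sqrt_le_one.2 hρ₁⟩
  have hrρ : ρ = r ^ 2 := by rw [hr, Real.sq_sqrt hρ₀]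
  rw [← hr, hrρ]
  have := isProbabilityMeasure_bernoulliLaw hp₀ hp₁
  have := isProbabilityMeasure_bernoulliLaw hr₀ hr₁
  have hp' : 0 ≤ 1 - p := by linarith
  have hr' : 0 ≤ 1 - r := by linarith
  -- Given the latent bit `x`, one member of the pair equals `x` with probability `r` and is a fresh
  -- Bernoulli variable otherwise.
  have hone : ∀ G : ℝ → ℝ≥0∞, Measurable G → ∀ x,
      ∫⁻ z, G (z.1 * x + (1 - z.1) * z.2) ∂((bernoulliLaw r).prod (bernoulliLaw p)) =
        ENNReal.ofReal r * G x + ENNReal.ofReal ((1 - r) * p) * G 1 +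
          ENNReal.ofReal ((1 - r) * (1 - p)) * G 0 := fun G hG x => by
    rw [lintegral_prod _ (by fun_prop), lintegral_bernoulliLaw, lintegral_bernoulliLaw,
      lintegral_bernoulliLaw, ENNReal.ofReal_mul hr', ENNReal.ofReal_mul hr']
    have : ENNReal.ofReal p + ENNReal.ofReal (1 - p) = 1 := by
      rw [← ENNReal.ofReal_add hp₀ hp']; simp
    have hG' : ENNReal.ofReal p * G x + ENNReal.ofReal (1 - p) * G x = G x := by
      rw [← add_mul, this, one_mul]
    simp only [one_mul, sub_self, zero_mul, add_zero, sub_zero, zero_add, hG']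
    ring
  refine Measure.ext_of_lintegral _ fun F hF => ?_
  have hF1 : ∀ a, Measurable fun b => F (a, b) := fun a => hF.comp (by fun_prop)
  have hF2 : ∀ x, Measurable fun a =>
      ENNReal.ofReal r * F (a, x) + ENNReal.ofReal ((1 - r) * p) * F (a, 1) +
        ENNReal.ofReal ((1 - r) * (1 - p)) * F (a, 0) := fun x => by
    have : ∀ b, Measurable fun a => F (a, b) := fun b =>
      hF.comp (by fun_prop : Measurable fun a : ℝ => (a, b))
    fun_prop (disch := assumption)
  rw [lintegral_latentLaw (by fun_prop) hF, lintegral_bernoulliLaw,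
    lintegral_bivariateBernoulliLaw]
  have hinner : ∀ x, ∫⁻ z, ∫⁻ z', F (z.1 * x + (1 - z.1) * z.2, z'.1 * x + (1 - z'.1) * z'.2)
      ∂((bernoulliLaw r).prod (bernoulliLaw p)) ∂((bernoulliLaw r).prod (bernoulliLaw p)) = _ :=
    fun x => (lintegral_congr fun z => hone _ (hF1 _) x).trans (hone _ (hF2 x) x)
  simp only [hinner]
  -- The probabilities of the joint values, split according to whether the latent bit is `1` or `0`.
  have e1 : ENNReal.ofReal (p ^ 2 + r ^ 2 * p * (1 - p)) =
      ENNReal.ofReal p * ((ENNReal.ofReal r + ENNReal.ofReal ((1 - r) * p)) ^ 2) +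
      ENNReal.ofReal (1 - p) * ENNReal.ofReal ((1 - r) * p) ^ 2 := by
    rw [← ENNReal.ofReal_add (by positivity) (by positivity), ← ENNReal.ofReal_pow (by positivity),
      ← ENNReal.ofReal_pow (by positivity), ← ENNReal.ofReal_mul (by positivity),
      ← ENNReal.ofReal_mul (by positivity), ← ENNReal.ofReal_add (by positivity) (by positivity)]
    congr 1
    ring
  have e2 : ENNReal.ofReal ((1 - r ^ 2) * p * (1 - p)) =
      ENNReal.ofReal p * ((ENNReal.ofReal r + ENNReal.ofReal ((1 - r) * p)) *
        ENNReal.ofReal ((1 - r) * (1 - p))) +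
      ENNReal.ofReal (1 - p) * ((ENNReal.ofReal r + ENNReal.ofReal ((1 - r) * (1 - p))) *
        ENNReal.ofReal ((1 - r) * p)) := by
    rw [← ENNReal.ofReal_add (by positivity) (by positivity),
      ← ENNReal.ofReal_add (by positivity) (by positivity),
      ← ENNReal.ofReal_mul (by positivity), ← ENNReal.ofReal_mul (by positivity),
      ← ENNReal.ofReal_mul (by positivity), ← ENNReal.ofReal_mul (by positivity),
      ← ENNReal.ofReal_add (by positivity) (by positivity)]
    congr 1
    ring
  have e3 : ENNReal.ofReal ((1 - p) ^ 2 + r ^ 2 * p * (1 - p)) =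
      ENNReal.ofReal p * ENNReal.ofReal ((1 - r) * (1 - p)) ^ 2 +
      ENNReal.ofReal (1 - p) *
        ((ENNReal.ofReal r + ENNReal.ofReal ((1 - r) * (1 - p))) ^ 2) := by
    rw [← ENNReal.ofReal_add (by positivity) (by positivity), ← ENNReal.ofReal_pow (by positivity),
      ← ENNReal.ofReal_pow (by positivity), ← ENNReal.ofReal_mul (by positivity),
      ← ENNReal.ofReal_mul (by positivity), ← ENNReal.ofReal_add (by positivity) (by positivity)]
    congr 1
    ring
  rw [e1, e2, e3]
  ring

lemma bivariateBernoulliLaw_marginals (hp₀ : 0 ≤ p) (hp₁ : p ≤ 1) (hρ₀ : 0 ≤ ρ) (hρ₁ : ρ ≤ 1) :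
    (bivariateBernoulliLaw p ρ).map Prod.fst = bernoulliLaw p ∧
      (bivariateBernoulliLaw p ρ).map Prod.snd = bernoulliLaw p := by
  have hp' : 0 ≤ 1 - p := by linarith
  have hρ' : 0 ≤ 1 - ρ := by linarith
  have e1 : ENNReal.ofReal p = ENNReal.ofReal (p ^ 2 + ρ * p * (1 - p)) +
      ENNReal.ofReal ((1 - ρ) * p * (1 - p)) := by
    rw [← ENNReal.ofReal_add (by positivity) (by positivity)]; congr 1; ring
  have e2 : ENNReal.ofReal (1 - p) = ENNReal.ofReal ((1 - p) ^ 2 + ρ * p * (1 - p)) +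
      ENNReal.ofReal ((1 - ρ) * p * (1 - p)) := by
    rw [← ENNReal.ofReal_add (by positivity) (by positivity)]; congr 1; ring
  constructor <;> refine Measure.ext_of_lintegral _ fun F hF => ?_
  · rw [lintegral_map hF measurable_fst, lintegral_bivariateBernoulliLaw, lintegral_bernoulliLaw,
      e1, e2]
    ring
  · rw [lintegral_map hF measurable_snd, lintegral_bivariateBernoulliLaw, lintegral_bernoulliLaw,
      e1, e2]
    ring

end Bernoulli

/-! ### The bivariate normal law as a mixture, and exponential moments -/

section Normal

variable {ρ : ℝ}

lemma posSemidef_correlation (hρ₀ : 0 ≤ ρ) (hρ₁ : ρ ≤ 1) :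
    (!![1, ρ; ρ, 1] : Matrix (Fin 2) (Fin 2) ℝ).PosSemidef := by
  refine Matrix.PosSemidef.of_dotProduct_mulVec_nonneg ?_ fun x => ?_
  · ext i j
    fin_cases i <;> fin_cases j <;> simp
  · simp [Matrix.mulVec, dotProduct, Fin.sum_univ_two]
    nlinarith [mul_nonneg hρ₀ (sq_nonneg (x 0 + x 1)),
      mul_nonneg (sub_nonneg.2 hρ₁) (sq_nonneg (x 0)),
      mul_nonneg (sub_nonneg.2 hρ₁) (sq_nonneg (x 1))]

instance : IsProbabilityMeasure (bivariateNormalLaw ρ) :=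
  Measure.isProbabilityMeasure_map (by fun_prop)

lemma bivariateNormalLaw_marginals (hρ₀ : 0 ≤ ρ) (hρ₁ : ρ ≤ 1) :
    (bivariateNormalLaw ρ).map Prod.fst = gaussianReal 0 1 ∧
      (bivariateNormalLaw ρ).map Prod.snd = gaussianReal 0 1 := by
  have h := fun i => (measurePreserving_eval_multivariateGaussian (μ := 0) (i := i)
    (posSemidef_correlation hρ₀ hρ₁)).map_eq
  constructor
  · rw [bivariateNormalLaw, Measure.map_map measurable_fst (by fun_prop)]
    simpa [Function.comp_def] using h 0
  · rw [bivariateNormalLaw, Measure.map_map measurable_snd (by fun_prop)]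
    simpa [Function.comp_def] using h 1

lemma integral_exp_bivariateNormalLaw (hρ₀ : 0 ≤ ρ) (hρ₁ : ρ ≤ 1) (s t : ℝ) :
    ∫ w, Complex.exp ((s * w.1 + t * w.2) * Complex.I) ∂(bivariateNormalLaw ρ) =
      Complex.exp (-((s ^ 2 + 2 * ρ * s * t + t ^ 2 : ℝ) / 2)) := by
  rw [bivariateNormalLaw, integral_map (by fun_prop) (by fun_prop)]
  have h := charFun_multivariateGaussian (μ := 0) (posSemidef_correlation hρ₀ hρ₁) !₂[s, t]
  rw [charFun_apply] at h
  simp only [PiLp.inner_apply, Fin.sum_univ_two] at h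
  convert h using 1
  · simp
  · simp [Matrix.mulVec, dotProduct, Fin.sum_univ_two]
    ring_nf

/-- A pair of correlated normal variables arises from a common normal variable by adding
independent normal noise. -/
lemma bivariateNormalLaw_eq_latentLaw (hρ₀ : 0 ≤ ρ) (hρ₁ : ρ ≤ 1) :
    bivariateNormalLaw ρ = latentLaw (gaussianReal 0 1) (gaussianReal 0 1)
      fun x z => √ρ * x + √(1 - ρ) * z := by
  have hΨ : Measurable fun q : ℝ × ℝ × ℝ =>
      (√ρ * q.1 + √(1 - ρ) * q.2.1, √ρ * q.1 + √(1 - ρ) * q.2.2) := by fun_prop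
  have : IsProbabilityMeasure (latentLaw (gaussianReal 0 1) (gaussianReal 0 1)
      fun x z => √ρ * x + √(1 - ρ) * z) := Measure.isProbabilityMeasure_map hΨ.aemeasurable
  have hm1 : Measurable fun q : ℝ × ℝ => (!₂[q.1, q.2] : EuclideanSpace ℝ (Fin 2)) := by fun_prop
  have hm2 : Measurable fun v : EuclideanSpace ℝ (Fin 2) => (v 0, v 1) := by fun_prop
  -- Characteristic functions refer to an inner product, so the two laws are compared after
  -- transport to the Euclidean plane.
  have hback : ∀ κ : Measure (ℝ × ℝ), (κ.map fun q : ℝ × ℝ =>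
      (!₂[q.1, q.2] : EuclideanSpace ℝ (Fin 2))).map (fun v => (v 0, v 1)) = κ := fun κ => by
    rw [Measure.map_map hm2 hm1]
    exact Measure.map_id
  rw [← hback (bivariateNormalLaw ρ), ← hback (latentLaw _ _ _)]
  congr 1
  have := Measure.isProbabilityMeasure_map (μ := bivariateNormalLaw ρ) hm1.aemeasurable
  have := Measure.isProbabilityMeasure_map (μ := latentLaw (gaussianReal 0 1) (gaussianReal 0 1)
      fun x z => √ρ * x + √(1 - ρ) * z) hm1.aemeasurable
  refine Measure.ext_of_charFun (funext fun v => ?_)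
  have hchar : ∀ κ : Measure (ℝ × ℝ), charFun (κ.map fun q : ℝ × ℝ =>
      (!₂[q.1, q.2] : EuclideanSpace ℝ (Fin 2))) v =
      ∫ w, Complex.exp ((v 0 * w.1 + v 1 * w.2) * Complex.I) ∂κ := fun κ => by
    rw [charFun_apply, integral_map hm1.aemeasurable (by fun_prop)]
    simp [PiLp.inner_apply, Fin.sum_univ_two]
  have hg : ∀ s : ℝ, ∫ x, Complex.exp (s * x * Complex.I) ∂(gaussianReal 0 1) =
      Complex.exp (-(s ^ 2 / 2 : ℝ)) := fun s => by
    rw [← charFun_apply_real, charFun_gaussianReal]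
    simp
  rw [hchar, hchar, integral_exp_bivariateNormalLaw hρ₀ hρ₁, latentLaw,
    integral_map hΨ.aemeasurable (by fun_prop)]
  have hsplit : ∀ q : ℝ × ℝ × ℝ, Complex.exp
      ((v 0 * (√ρ * q.1 + √(1 - ρ) * q.2.1 : ℝ) + v 1 * (√ρ * q.1 + √(1 - ρ) * q.2.2 : ℝ)) *
        Complex.I) =
      Complex.exp ((√ρ * (v 0 + v 1) : ℝ) * q.1 * Complex.I) *
        (Complex.exp ((√(1 - ρ) * v 0 : ℝ) * q.2.1 * Complex.I) *
          Complex.exp ((√(1 - ρ) * v 1 : ℝ) * q.2.2 * Complex.I)) := fun q => by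
    rw [← Complex.exp_add, ← Complex.exp_add]
    congr 1
    push_cast
    ring
  simp only [hsplit]
  rw [integral_prod_mul (fun x : ℝ => Complex.exp ((√ρ * (v 0 + v 1) : ℝ) * x * Complex.I))
    (fun z : ℝ × ℝ => Complex.exp ((√(1 - ρ) * v 0 : ℝ) * z.1 * Complex.I) *
          Complex.exp ((√(1 - ρ) * v 1 : ℝ) * z.2 * Complex.I)),
    integral_prod_mul (fun z : ℝ => Complex.exp ((√(1 - ρ) * v 0 : ℝ) * z * Complex.I))
    (fun z : ℝ => Complex.exp ((√(1 - ρ) * v 1 : ℝ) * z * Complex.I)), hg, hg, hg,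
    ← Complex.exp_add, ← Complex.exp_add, mul_pow, mul_pow, mul_pow, Real.sq_sqrt hρ₀,
    Real.sq_sqrt (by linarith)]
  congr 1
  push_cast
  ring

lemma bivariateNormalLaw_map_add (hρ₀ : 0 ≤ ρ) (hρ₁ : ρ ≤ 1) :
    (bivariateNormalLaw ρ).map (fun w => w.1 + w.2) = gaussianReal 0 (2 * (1 + ρ)).toNNReal := by
  have hm : Measurable fun w : ℝ × ℝ => w.1 + w.2 := by fun_prop
  have := Measure.isProbabilityMeasure_map (μ := bivariateNormalLaw ρ) hm.aemeasurable
  refine Measure.ext_of_charFun (funext fun s => ?_)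
  rw [charFun_apply_real, integral_map hm.aemeasurable (by fun_prop), charFun_gaussianReal,
    Real.coe_toNNReal _ (by linarith)]
  have h := integral_exp_bivariateNormalLaw hρ₀ hρ₁ s s
  push_cast at h ⊢
  simp only [mul_add, h]
  congr 1
  ring

lemma lintegral_exp_sq_gaussianReal_lt_top {v : NNReal} (hv : 0 < v) {c : ℝ}
    (hc : c < 1 / (2 * v)) :
    ∫⁻ x, ENNReal.ofReal (Real.exp (c * x ^ 2)) ∂(gaussianReal 0 v) < ∞ := by
  rw [gaussianReal_of_var_ne_zero _ hv.ne', lintegral_withDensity_eq_lintegral_mul _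
    (measurable_gaussianPDF _ _) (by fun_prop)]
  have hint := ((integrable_exp_neg_mul_sq (sub_pos.2 hc)).const_mul
    (√(2 * Real.pi * v))⁻¹).lintegral_lt_top
  refine lt_of_eq_of_lt (lintegral_congr fun x => ?_) hint
  simp only [Pi.mul_apply, gaussianPDF, gaussianPDFReal, sub_zero]
  rw [← ENNReal.ofReal_mul (by positivity), mul_assoc, ← Real.exp_add]
  congr 3
  ring

/-- Since `a * b ≤ (a + b) ^ 2 / 4` and `a + b` has variance `2 * (1 + ρ)`, it suffices that `t / 4
< 1 / (4 * (1 + ρ))`, which is the assumed bound on `t`. -/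
lemma lintegral_exp_mul_bivariateNormalLaw_lt_top (hρ₀ : 0 ≤ ρ) (hρ₁ : ρ ≤ 1) {t : ℝ}
    (ht₀ : 0 ≤ t) (ht : t < 1 / (1 + ρ)) :
    ∫⁻ w, ENNReal.ofReal (Real.exp (t * (w.1 * w.2))) ∂(bivariateNormalLaw ρ) < ∞ := by
  have hv : 0 < (2 * (1 + ρ)).toNNReal := Real.toNNReal_pos.2 (by linarith)
  have hlt : t / 4 < 1 / (2 * ((2 * (1 + ρ)).toNNReal : ℝ)) := by
    rw [Real.coe_toNNReal _ (by linarith)]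
    rw [lt_div_iff₀ (by linarith)] at ht ⊢
    linarith
  have h := lintegral_exp_sq_gaussianReal_lt_top hv hlt
  rw [← bivariateNormalLaw_map_add hρ₀ hρ₁, lintegral_map (by fun_prop) (by fun_prop)] at h
  refine lt_of_le_of_lt (lintegral_mono fun w => ?_) h
  refine ENNReal.ofReal_le_ofReal (Real.exp_le_exp.2 ?_)
  nlinarith [mul_nonneg ht₀ (sq_nonneg (w.1 - w.2))]

end Normal

/-! ### Cumulant generating functions of paths and cycles -/

section CumulantBounds

/-- No integrability is needed: if the expectation is infinite, the Bochner integral and `toReal`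
both take the value `0`. -/
lemma cgf_eq_log_lintegral {Ω : Type*} [MeasurableSpace Ω] {μ : Measure Ω} {X : Ω → ℝ}
    (hX : AEMeasurable X μ) (t : ℝ) :
    cgf X μ t = Real.log (∫⁻ ω, ENNReal.ofReal (Real.exp (t * X ω)) ∂μ).toReal := by
  rw [cgf, mgf, integral_eq_lintegral_of_nonneg_ae
    (Filter.Eventually.of_forall fun _ => (Real.exp_pos _).le)]
  exact (hX.const_mul t).exp.aestronglyMeasurable

lemma integrable_exp_of_lintegral {Ω : Type*} [MeasurableSpace Ω] {μ : Measure Ω} {X : Ω → ℝ}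
    (hX : AEMeasurable X μ) {t : ℝ}
    (h : ∫⁻ ω, ENNReal.ofReal (Real.exp (t * X ω)) ∂μ < ∞) :
    Integrable (fun ω => Real.exp (t * X ω)) μ :=
  (lintegral_ofReal_ne_top_iff_integrable (hX.const_mul t).exp.aestronglyMeasurable
    (Filter.Eventually.of_forall fun _ => (Real.exp_pos _).le)).1 h.ne

lemma lintegral_exp_pos {Ω : Type*} [MeasurableSpace Ω] (μ : Measure Ω) [IsProbabilityMeasure μ]
    {X : Ω → ℝ} (hX : AEMeasurable X μ) (t : ℝ) :
    0 < ∫⁻ ω, ENNReal.ofReal (Real.exp (t * X ω)) ∂μ := by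
  rw [pos_iff_ne_zero, Ne, lintegral_eq_zero_iff' (by fun_prop)]
  intro h
  obtain ⟨ω, hω⟩ := h.exists
  simp only [Pi.zero_apply, ENNReal.ofReal_eq_zero] at hω
  exact absurd (Real.exp_pos _) (not_lt.2 hω)

/-- The exponential of the score of a pair of weights. -/
def expScore (f : ℝ → ℝ → ℝ) (t a b : ℝ) : ℝ≥0∞ := ENNReal.ofReal (Real.exp (t * f a b))

lemma ofReal_exp_sum {I : Type*} (s : Finset I) (t : ℝ) (g : I → ℝ) :
    ENNReal.ofReal (Real.exp (t * ∑ i ∈ s, g i)) =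
      ∏ i ∈ s, ENNReal.ofReal (Real.exp (t * g i)) := by
  rw [Finset.mul_sum, Real.exp_sum, ENNReal.ofReal_prod_of_nonneg fun i _ => (Real.exp_pos _).le]

/-- The correlated pairs have a latent variable representation, and the exponential of the score
is a positive kernel with finite expectation. -/
structure IsLatentModel {Z : Type*} [MeasurableSpace Z] (m : Measure ℝ) (ν : Measure (ℝ × ℝ))
    (f : ℝ → ℝ → ℝ) (t : ℝ) (ζ : Measure Z) (Φ : ℝ → Z → ℝ) : Prop where
  prob_vertex : IsProbabilityMeasure m
  prob_noise : IsProbabilityMeasure ζ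
  measurable_latent : Measurable fun q : ℝ × Z => Φ q.1 q.2
  law_eq : ν = latentLaw m ζ Φ
  map_fst : ν.map Prod.fst = m
  map_snd : ν.map Prod.snd = m
  measurable_score : Measurable fun q : ℝ × ℝ => f q.1 q.2
  gram : IsGram (expScore f t)
  finite : ∫⁻ w, expScore f t w.1 w.2 ∂ν < ∞

namespace IsLatentModel

variable {Z : Type*} [MeasurableSpace Z] {m : Measure ℝ} {ν : Measure (ℝ × ℝ)}
  {f : ℝ → ℝ → ℝ} {t : ℝ} {ζ : Measure Z} {Φ : ℝ → Z → ℝ}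

lemma measurable_expScore (h : IsLatentModel m ν f t ζ Φ) :
    Measurable fun q : ℝ × ℝ => expScore f t q.1 q.2 := by
  have := h.measurable_score
  unfold expScore
  fun_prop

lemma prob (h : IsLatentModel m ν f t ζ Φ) : IsProbabilityMeasure ν := by
  have := h.prob_vertex
  have := h.prob_noise
  rw [h.law_eq]
  exact Measure.isProbabilityMeasure_map (measurable_latent_pair h.measurable_latent).aemeasurable

lemma measurable_kernel (h : IsLatentModel m ν f t ζ Φ) :
    Measurable fun q : ℝ × ℝ => latentKernel ζ Φ (expScore f t) q.1 q.2 :=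
  have := h.prob_noise
  measurable_latentKernel h.measurable_latent h.measurable_expScore

lemma isGram_kernel (h : IsLatentModel m ν f t ζ Φ) : IsGram (latentKernel ζ Φ (expScore f t)) :=
  have := h.prob_noise
  h.gram.latentKernel h.measurable_latent

lemma measurable_pathScore (h : IsLatentModel m ν f t ζ Φ) (ℓ : ℕ) :
    Measurable (pathScore f ℓ) :=
  Finset.measurable_fun_sum _ fun i _ => h.measurable_score.comp (by fun_prop :
    Measurable fun w : Fin (ℓ + 1) → ℝ × ℝ => ((w i.castSucc).1, (w i.succ).2))

lemma measurable_cycleScore (h : IsLatentModel m ν f t ζ Φ) (ℓ : ℕ) :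
    Measurable (cycleScore f ℓ) :=
  Finset.measurable_fun_sum _ fun i _ => h.measurable_score.comp (by fun_prop :
    Measurable fun w : Fin ℓ → ℝ × ℝ => ((w i).1, (w (finRotate ℓ i)).2))

/-- The index is shifted because `kernelPow m M n` is the power `M ^ (n + 1)`. -/
lemma lintegral_exp_pathScore (h : IsLatentModel m ν f t ζ Φ) (n : ℕ) :
    ∫⁻ w, ENNReal.ofReal (Real.exp (t * pathScore f (n + 1) w)) ∂(Measure.pi fun _ => ν) =
      ∫⁻ x, ∫⁻ y, kernelPow m (latentKernel ζ Φ (expScore f t)) n x y ∂m ∂m := by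
  have := h.prob_vertex
  have := h.prob_noise
  rw [← lintegral_pi_path h.measurable_kernel, ← lintegral_pi_latentLaw h.measurable_latent
    h.measurable_expScore (Fin.castSucc_injective _) (Fin.succ_injective _), ← h.law_eq]
  simp only [pathScore, ofReal_exp_sum, expScore]

lemma lintegral_exp_cycleScore (h : IsLatentModel m ν f t ζ Φ) (n : ℕ) :
    ∫⁻ w, ENNReal.ofReal (Real.exp (t * cycleScore f (n + 1) w)) ∂(Measure.pi fun _ => ν) =
      kernelTrace m (kernelPow m (latentKernel ζ Φ (expScore f t)) n) := by
  have := h.prob_vertex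
  have := h.prob_noise
  rw [← lintegral_pi_cycle h.measurable_kernel]
  refine Eq.trans ?_ (lintegral_pi_latentLaw (a := id) h.measurable_latent
    h.measurable_expScore Function.injective_id (finRotate _).injective)
  rw [← h.law_eq]
  simp only [cycleScore, ofReal_exp_sum, expScore, id]

lemma kernelTrace_lt_top (h : IsLatentModel m ν f t ζ Φ) :
    kernelTrace m (latentKernel ζ Φ (expScore f t)) < ∞ := by
  have := h.prob_vertex
  have := h.prob_noise
  rw [kernelTrace_latentKernel h.measurable_latent h.measurable_expScore, ← h.law_eq]
  exact h.finite

lemma kernelSq_lt_top (h : IsLatentModel m ν f t ζ Φ) :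
    kernelSq m (latentKernel ζ Φ (expScore f t)) < ∞ :=
  (h.isGram_kernel.kernelSq_le h.measurable_kernel).trans_lt
    (ENNReal.pow_lt_top h.kernelTrace_lt_top)

lemma kernelTrace_kernelPow_one (h : IsLatentModel m ν f t ζ Φ) :
    kernelTrace m (kernelPow m (latentKernel ζ Φ (expScore f t)) 1) =
      kernelSq m (latentKernel ζ Φ (expScore f t)) := by
  refine lintegral_congr fun x => lintegral_congr fun y => ?_
  rw [kernelPow, sq, h.isGram_kernel.symm y x]

/-- The rotation of `n + 2 ≥ 2` points has no fixed point. The cycle thus contains no loop, and each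
of its arcs contributes a Hilbert-Schmidt norm. -/
lemma kernelTrace_kernelPow_le (h : IsLatentModel m ν f t ζ Φ) (n : ℕ) :
    kernelTrace m (kernelPow m (latentKernel ζ Φ (expScore f t)) (n + 1)) ≤
      (kernelSq m (latentKernel ζ Φ (expScore f t)) ^ (1 / 2 : ℝ)) ^ (n + 2) := by
  have := h.prob_vertex
  rw [← lintegral_pi_cycle h.measurable_kernel]
  refine (lintegral_pi_prod_kernel_le (a := id) h.measurable_kernel Function.injective_id
    (finRotate _).injective).trans (le_of_eq ?_)
  simp

lemma kernelPow_lintegral_le (h : IsLatentModel m ν f t ζ Φ) (n : ℕ) :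
    ∫⁻ x, ∫⁻ y, kernelPow m (latentKernel ζ Φ (expScore f t)) n x y ∂m ∂m ≤
      kernelTrace m (kernelPow m (latentKernel ζ Φ (expScore f t)) n) :=
  have := h.prob_vertex
  (h.isGram_kernel.kernelPow h.measurable_kernel n).lintegral_le_trace

lemma kernelTrace_kernelPow_lt_top (h : IsLatentModel m ν f t ζ Φ) (n : ℕ) :
    kernelTrace m (kernelPow m (latentKernel ζ Φ (expScore f t)) n) < ∞ := by
  cases n with
  | zero => exact h.kernelTrace_lt_top
  | succ n =>
    exact (h.kernelTrace_kernelPow_le n).trans_lt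
      (ENNReal.pow_lt_top (ENNReal.rpow_lt_top_of_nonneg (by norm_num) h.kernelSq_lt_top.ne))

lemma integrable_path (h : IsLatentModel m ν f t ζ Φ) (ℓ : ℕ) :
    Integrable (fun w => Real.exp (t * pathScore f ℓ w)) (Measure.pi fun _ => ν) := by
  have := h.prob
  cases ℓ with
  | zero => simp [pathScore]
  | succ n =>
    refine integrable_exp_of_lintegral (h.measurable_pathScore _).aemeasurable ?_
    rw [h.lintegral_exp_pathScore]
    exact (h.kernelPow_lintegral_le n).trans_lt (h.kernelTrace_kernelPow_lt_top n)

lemma integrable_cycle (h : IsLatentModel m ν f t ζ Φ) (ℓ : ℕ) :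
    Integrable (fun w => Real.exp (t * cycleScore f ℓ w)) (Measure.pi fun _ => ν) := by
  have := h.prob
  cases ℓ with
  | zero => simp [cycleScore]
  | succ n =>
    refine integrable_exp_of_lintegral (h.measurable_cycleScore _).aemeasurable ?_
    rw [h.lintegral_exp_cycleScore]
    exact h.kernelTrace_kernelPow_lt_top n

lemma pathCGF_succ (h : IsLatentModel m ν f t ζ Φ) (n : ℕ) :
    pathCGF ν f (n + 1) t = Real.log
      (∫⁻ x, ∫⁻ y, kernelPow m (latentKernel ζ Φ (expScore f t)) n x y ∂m ∂m).toReal := by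
  rw [pathCGF, cgf_eq_log_lintegral (h.measurable_pathScore _).aemeasurable,
    h.lintegral_exp_pathScore]

lemma cycleCGF_succ (h : IsLatentModel m ν f t ζ Φ) (n : ℕ) :
    cycleCGF ν f (n + 1) t = Real.log
      (kernelTrace m (kernelPow m (latentKernel ζ Φ (expScore f t)) n)).toReal := by
  rw [cycleCGF, cgf_eq_log_lintegral (h.measurable_cycleScore _).aemeasurable,
    h.lintegral_exp_cycleScore]

lemma cycleCGF_one (h : IsLatentModel m ν f t ζ Φ) :
    cycleCGF ν f 1 t = Real.log (kernelTrace m (latentKernel ζ Φ (expScore f t))).toReal :=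
  h.cycleCGF_succ 0

lemma cycleCGF_two (h : IsLatentModel m ν f t ζ Φ) :
    cycleCGF ν f 2 t = Real.log (kernelSq m (latentKernel ζ Φ (expScore f t))).toReal := by
  rw [h.cycleCGF_succ 1, h.kernelTrace_kernelPow_one]

/-- Positivity is read off from the original expectation of an exponential. Being a lower bound for
the trace, it makes all logarithms below monotone. -/
lemma path_pos (h : IsLatentModel m ν f t ζ Φ) (n : ℕ) :
    0 < ∫⁻ x, ∫⁻ y, kernelPow m (latentKernel ζ Φ (expScore f t)) n x y ∂m ∂m := by
  have := h.prob
  rw [← h.lintegral_exp_pathScore]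
  exact lintegral_exp_pos _ (h.measurable_pathScore _).aemeasurable t

lemma cycle_pos (h : IsLatentModel m ν f t ζ Φ) (n : ℕ) :
    0 < kernelTrace m (kernelPow m (latentKernel ζ Φ (expScore f t)) n) :=
  (h.path_pos n).trans_le (h.kernelPow_lintegral_le n)

lemma kernelSq_pos (h : IsLatentModel m ν f t ζ Φ) :
    0 < kernelSq m (latentKernel ζ Φ (expScore f t)) :=
  h.kernelTrace_kernelPow_one ▸ h.cycle_pos 1

end IsLatentModel

lemma log_toReal_le {x y : ℝ≥0∞} (hx : 0 < x) (hy : y < ∞) (hxy : x ≤ y) :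
    Real.log x.toReal ≤ Real.log y.toReal :=
  Real.log_le_log (ENNReal.toReal_pos hx.ne' (hxy.trans_lt hy).ne)
    (ENNReal.toReal_mono hy.ne hxy)

namespace IsLatentModel

variable {Z : Type*} [MeasurableSpace Z] {m : Measure ℝ} {ν : Measure (ℝ × ℝ)}
  {f : ℝ → ℝ → ℝ} {t : ℝ} {ζ : Measure Z} {Φ : ℝ → Z → ℝ}

lemma pathCGF_one_le (h : IsLatentModel m ν f t ζ Φ) :
    pathCGF ν f 1 t ≤ 1 / 2 * cycleCGF ν f 2 t := by
  have := h.prob_vertex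
  have hle := log_toReal_le (ENNReal.pow_pos (h.path_pos 0) 2) h.kernelSq_lt_top
    (sq_lintegral_le_kernelSq h.measurable_kernel)
  rw [ENNReal.toReal_pow, Real.log_pow] at hle
  rw [h.pathCGF_succ 0, h.cycleCGF_two]
  push_cast at hle
  linarith

lemma cycleCGF_two_le (h : IsLatentModel m ν f t ζ Φ) :
    1 / 2 * cycleCGF ν f 2 t ≤ cycleCGF ν f 1 t := by
  have hle := log_toReal_le h.kernelSq_pos (ENNReal.pow_lt_top h.kernelTrace_lt_top)
    (h.isGram_kernel.kernelSq_le h.measurable_kernel)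
  rw [ENNReal.toReal_pow, Real.log_pow] at hle
  rw [h.cycleCGF_one, h.cycleCGF_two]
  push_cast at hle
  linarith

lemma pathCGF_le_cycleCGF (h : IsLatentModel m ν f t ζ Φ) (n : ℕ) :
    pathCGF ν f (n + 1) t ≤ cycleCGF ν f (n + 1) t := by
  rw [h.pathCGF_succ, h.cycleCGF_succ]
  exact log_toReal_le (h.path_pos n) (h.kernelTrace_kernelPow_lt_top n) (h.kernelPow_lintegral_le n)

lemma cycleCGF_le (h : IsLatentModel m ν f t ζ Φ) (n : ℕ) :
    cycleCGF ν f (n + 2) t ≤ ((n + 2 : ℕ) : ℝ) / 2 * cycleCGF ν f 2 t := by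
  have hle := log_toReal_le (h.cycle_pos (n + 1))
    (ENNReal.pow_lt_top (ENNReal.rpow_lt_top_of_nonneg (by norm_num) h.kernelSq_lt_top.ne))
    (h.kernelTrace_kernelPow_le n)
  rw [ENNReal.toReal_pow, Real.log_pow, ← ENNReal.toReal_rpow,
    Real.log_rpow (ENNReal.toReal_pos h.kernelSq_pos.ne' h.kernelSq_lt_top.ne)] at hle
  rw [h.cycleCGF_succ (n + 1), h.cycleCGF_two]
  linarith

end IsLatentModel

end CumulantBounds

/-! ### The three models -/

section Models

lemma isLatentModel_bernoulli {p ρ t : ℝ} (hp₀ : 0 ≤ p) (hp₁ : p ≤ 1) (hρ₀ : 0 ≤ ρ) (hρ₁ : ρ ≤ 1)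
    (ht : 0 ≤ t) :
    IsLatentModel (bernoulliLaw p) (bivariateBernoulliLaw p ρ) (fun x y => x * y) t
      ((bernoulliLaw √ρ).prod (bernoulliLaw p)) fun x z => z.1 * x + (1 - z.1) * z.2 where
  prob_vertex := isProbabilityMeasure_bernoulliLaw hp₀ hp₁
  prob_noise := by
    have := isProbabilityMeasure_bernoulliLaw hp₀ hp₁
    have := isProbabilityMeasure_bernoulliLaw (Real.sqrt_nonneg ρ) (Real.sqrt_le_one.2 hρ₁)
    infer_instance
  measurable_latent := by fun_prop
  law_eq := bivariateBernoulliLaw_eq_latentLaw hp₀ hp₁ hρ₀ hρ₁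
  map_fst := (bivariateBernoulliLaw_marginals hp₀ hp₁ hρ₀ hρ₁).1
  map_snd := (bivariateBernoulliLaw_marginals hp₀ hp₁ hρ₀ hρ₁).2
  measurable_score := by fun_prop
  gram := isGram_exp_mul ht
  finite := by
    rw [lintegral_bivariateBernoulliLaw]
    simp only [expScore]
    finiteness

lemma isLatentModel_normal_mul {ρ t : ℝ} (hρ₀ : 0 ≤ ρ) (hρ₁ : ρ ≤ 1) (ht₀ : 0 ≤ t)
    (ht₁ : t < 1 / (1 + ρ)) :
    IsLatentModel (gaussianReal 0 1) (bivariateNormalLaw ρ) (fun x y => x * y) t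
      (gaussianReal 0 1) fun x z => √ρ * x + √(1 - ρ) * z where
  prob_vertex := inferInstance
  prob_noise := inferInstance
  measurable_latent := by fun_prop
  law_eq := bivariateNormalLaw_eq_latentLaw hρ₀ hρ₁
  map_fst := (bivariateNormalLaw_marginals hρ₀ hρ₁).1
  map_snd := (bivariateNormalLaw_marginals hρ₀ hρ₁).2
  measurable_score := by fun_prop
  gram := isGram_exp_mul ht₀
  finite := lintegral_exp_mul_bivariateNormalLaw_lt_top hρ₀ hρ₁ ht₀ ht₁

lemma isLatentModel_normal_sq_sub {ρ t : ℝ} (hρ₀ : 0 ≤ ρ) (hρ₁ : ρ ≤ 1) (ht : 0 ≤ t) :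
    IsLatentModel (gaussianReal 0 1) (bivariateNormalLaw ρ)
      (fun x y => -(1 / 2) * (x - y) ^ 2) t
      (gaussianReal 0 1) fun x z => √ρ * x + √(1 - ρ) * z where
  prob_vertex := inferInstance
  prob_noise := inferInstance
  measurable_latent := by fun_prop
  law_eq := bivariateNormalLaw_eq_latentLaw hρ₀ hρ₁
  map_fst := (bivariateNormalLaw_marginals hρ₀ hρ₁).1
  map_snd := (bivariateNormalLaw_marginals hρ₀ hρ₁).2
  measurable_score := by fun_prop
  gram := isGram_exp_sq_sub ht
  finite := by
    -- The score is nonpositive, so its exponential is at most `1`.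
    refine lt_of_le_of_lt (lintegral_mono (g := fun _ => 1) fun w => ?_) (by simp)
    rw [expScore, ENNReal.ofReal_le_one, Real.exp_le_one_iff]
    nlinarith [mul_nonneg ht (sq_nonneg (w.1 - w.2))]

end Models

/-! ### Injections acting on pairs of vertices -/

section Pairs

variable {V V₁ V₂ : Type*} [DecidableEq V] [DecidableEq V₁]

lemma mem_pairs {S : Finset V} {e : Sym2 V} : e ∈ pairs S ↔ (∀ x ∈ e, x ∈ S) ∧ ¬ e.IsDiag := by
  rw [pairs, Finset.mem_filter, Finset.mem_sym2_iff]

lemma pairs_subset_univ [Fintype V] (S : Finset V) : pairs S ⊆ pairs Finset.univ := fun _ he =>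
  mem_pairs.2 ⟨fun x _ => Finset.mem_univ x, (mem_pairs.1 he).2⟩

lemma map_injOn_pairs {S : Finset V₁} {π : V₁ → V₂} (hπ : Set.InjOn π S) {e e' : Sym2 V₁}
    (he : e ∈ pairs S) (he' : e' ∈ pairs S) (h : e.map π = e'.map π) : e = e' := by
  induction e with
  | _ x y =>
    induction e' with
    | _ x' y' =>
      simp only [mem_pairs, Sym2.mem_iff, forall_eq_or_imp, forall_eq] at he he'
      simp only [Sym2.map_mk, Sym2.eq_iff] at h ⊢
      rcases h with ⟨h1, h2⟩ | ⟨h1, h2⟩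
      · exact Or.inl ⟨hπ he.1.1 he'.1.1 h1, hπ he.1.2 he'.1.2 h2⟩
      · exact Or.inr ⟨hπ he.1.1 he'.1.2 h1, hπ he.1.2 he'.1.1 h2⟩

variable [DecidableEq V₂]

lemma map_mem_pairs_image {S : Finset V₁} {π : V₁ → V₂} (hπ : Set.InjOn π S) {e : Sym2 V₁}
    (he : e ∈ pairs S) : e.map π ∈ pairs (S.image π) := by
  induction e with
  | _ x y =>
    simp only [mem_pairs, Sym2.mem_iff, forall_eq_or_imp, forall_eq, Sym2.mk_isDiag_iff] at he
    simp only [mem_pairs, Sym2.map_mk, Sym2.mem_iff, forall_eq_or_imp, forall_eq,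
      Sym2.mk_isDiag_iff]
    exact ⟨⟨Finset.mem_image_of_mem _ he.1.1, Finset.mem_image_of_mem _ he.1.2⟩,
      fun h => he.2 (hπ he.1.1 he.1.2 h)⟩

lemma exists_map_eq_of_mem_pairs_image {S : Finset V₁} {π : V₁ → V₂} {e : Sym2 V₂}
    (he : e ∈ pairs (S.image π)) : ∃ e' ∈ pairs S, e'.map π = e := by
  induction e with
  | _ x y =>
    simp only [mem_pairs, Sym2.mem_iff, forall_eq_or_imp, forall_eq, Sym2.mk_isDiag_iff,
      Finset.mem_image] at he
    obtain ⟨⟨⟨a, ha, rfl⟩, b, hb, rfl⟩, hne⟩ := he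
    refine ⟨s(a, b), ?_, rfl⟩
    simp only [mem_pairs, Sym2.mem_iff, forall_eq_or_imp, forall_eq, Sym2.mk_isDiag_iff]
    exact ⟨⟨ha, hb⟩, fun h => hne (h ▸ rfl)⟩

end Pairs

/-! ### Vertices of the digraph and the weights they carry -/

section Nodes

variable {V₁ V₂ : Type*} [DecidableEq V₁] {Sstar : Finset V₁} {πstar : V₁ → V₂}

/-- The representative of a vertex of the correlated functional digraph that is a pair of vertices
of the second graph whenever possible. -/
def Node.repr : Node Sstar πstar → Sym2 V₁ ⊕ Sym2 V₂ :=
  Quot.lift (Sum.elim (fun e => if e ∈ pairs Sstar then .inr (e.map πstar) else .inl e) .inr) <| by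
    rintro _ _ ⟨e, he, rfl, rfl⟩
    simp [he]

lemma mk_inr_injective {e e' : Sym2 V₂}
    (h : (Quot.mk _ (.inr e) : Node Sstar πstar) = Quot.mk _ (.inr e')) : e = e' :=
  Sum.inr_injective (congrArg Node.repr h)

lemma mk_inl_eq_mk_inr {e : Sym2 V₁} {e' : Sym2 V₂}
    (h : (Quot.mk _ (.inl e) : Node Sstar πstar) = Quot.mk _ (.inr e')) :
    e ∈ pairs Sstar ∧ e.map πstar = e' := by
  have h' := congrArg Node.repr h
  simp only [Node.repr, Sum.elim_inl, Sum.elim_inr] at h'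
  split_ifs at h' with he
  exact ⟨he, Sum.inr_injective h'⟩

/-- Two pairs of the first graph could be identified only through a common image under `πstar`,
which injectivity on `Sstar` excludes. -/
lemma mk_inl_injective (hinj : Set.InjOn πstar Sstar) {e e' : Sym2 V₁}
    (h : (Quot.mk _ (.inl e) : Node Sstar πstar) = Quot.mk _ (.inl e')) : e = e' := by
  have h' := congrArg Node.repr h
  simp only [Node.repr, Sum.elim_inl] at h'
  split_ifs at h' with he he' he'
  · exact map_injOn_pairs hinj he he' (Sum.inr_injective h')
  · exact Sum.inl_injective h'

lemma mk_inl_eq_mk_map {e : Sym2 V₁} (he : e ∈ pairs Sstar) :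
    (Quot.mk _ (.inl e) : Node Sstar πstar) = Quot.mk _ (.inr (e.map πstar)) :=
  Quot.sound ⟨e, he, rfl, rfl⟩

variable [DecidableEq V₂] [Fintype V₁] [Fintype V₂]

variable (Sstar πstar) in
/-- The indices of the independent family of weights of two partially correlated graphs. -/
abbrev WeightIndex : Type _ :=
  {e // e ∈ pairs Sstar} ⊕ {e // e ∈ pairs (Finset.univ : Finset V₁) \ pairs Sstar} ⊕
    {e // e ∈ pairs (Finset.univ : Finset V₂) \ pairs (Sstar.image πstar)}

/-- The vertex of the correlated functional digraph that carries a given weight. -/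
def weightNode : WeightIndex Sstar πstar → Node Sstar πstar
  | .inl e => Quot.mk _ (.inl e.1)
  | .inr (.inl e) => Quot.mk _ (.inl e.1)
  | .inr (.inr e) => Quot.mk _ (.inr e.1)

lemma exists_weightNode_eq_inl {e : Sym2 V₁} (he : e ∈ pairs (Finset.univ : Finset V₁)) :
    ∃ k : WeightIndex Sstar πstar, weightNode k = Quot.mk _ (.inl e) := by
  by_cases h : e ∈ pairs Sstar
  · exact ⟨.inl ⟨e, h⟩, rfl⟩
  · exact ⟨.inr (.inl ⟨e, Finset.mem_sdiff.2 ⟨he, h⟩⟩), rfl⟩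

lemma exists_weightNode_eq_inr {e : Sym2 V₂} (he : e ∈ pairs (Finset.univ : Finset V₂)) :
    ∃ k : WeightIndex Sstar πstar, weightNode k = Quot.mk _ (.inr e) := by
  by_cases h : e ∈ pairs (Sstar.image πstar)
  · obtain ⟨e', he', rfl⟩ := exists_map_eq_of_mem_pairs_image h
    exact ⟨.inl ⟨e', he'⟩, mk_inl_eq_mk_map he'⟩
  · exact ⟨.inr (.inr ⟨e, Finset.mem_sdiff.2 ⟨he, h⟩⟩), rfl⟩

/-- The pair of weights at a vertex of the correlated functional digraph. -/
def weightPair {Ω : Type*} (A : Sym2 V₁ → Ω → ℝ) (B : Sym2 V₂ → Ω → ℝ)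
    (k : WeightIndex Sstar πstar) (ω : Ω) : ℝ × ℝ :=
  match k with
  | .inl e => (A e.1 ω, B (e.1.map πstar) ω)
  | .inr (.inl e) => (A e.1 ω, 0)
  | .inr (.inr e) => (0, B e.1 ω)

variable {Ω : Type*} {A : Sym2 V₁ → Ω → ℝ} {B : Sym2 V₂ → Ω → ℝ}

lemma weightNode_ne_inl {e : {e // e ∈ pairs (Finset.univ : Finset V₂) \ pairs (Sstar.image πstar)}}
    (hinj : Set.InjOn πstar Sstar) (e' : Sym2 V₁) :
    weightNode (.inr (.inr e) : WeightIndex Sstar πstar) ≠ Quot.mk _ (.inl e') := fun h => by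
  obtain ⟨he', heq⟩ := mk_inl_eq_mk_inr h.symm
  exact (Finset.mem_sdiff.1 e.2).2 (heq ▸ map_mem_pairs_image hinj he')

lemma weightNode_ne_inr {e : {e // e ∈ pairs (Finset.univ : Finset V₁) \ pairs Sstar}}
    (e' : Sym2 V₂) :
    weightNode (.inr (.inl e) : WeightIndex Sstar πstar) ≠ Quot.mk _ (.inr e') := fun h =>
  (Finset.mem_sdiff.1 e.2).2 (mk_inl_eq_mk_inr h).1

/-- The padding `0` of an unmerged pair of the second graph is never read here, because such a
vertex is not represented by a pair of the first graph. -/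
lemma weightPair_fst (hinj : Set.InjOn πstar Sstar) {k : WeightIndex Sstar πstar} {e : Sym2 V₁}
    (h : weightNode k = Quot.mk _ (.inl e)) (ω : Ω) : (weightPair A B k ω).1 = A e ω := by
  match k with
  | .inl e' => rw [← mk_inl_injective hinj h]; rfl
  | .inr (.inl e') => rw [← mk_inl_injective hinj h]; rfl
  | .inr (.inr e') => exact absurd h (weightNode_ne_inl hinj e)

lemma weightPair_snd {k : WeightIndex Sstar πstar} {e : Sym2 V₂}
    (h : weightNode k = Quot.mk _ (.inr e)) (ω : Ω) : (weightPair A B k ω).2 = B e ω := by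
  match k with
  | .inl e' => rw [← (mk_inl_eq_mk_inr h).2]; rfl
  | .inr (.inl e') => exact absurd h (weightNode_ne_inr e)
  | .inr (.inr e') => rw [← mk_inr_injective h]; rfl

end Nodes

/-! ### The joint law of the weights along a set of arcs -/

section Law

variable {V₁ V₂ Ω : Type*} [DecidableEq V₁] [DecidableEq V₂] [Fintype V₁] [Fintype V₂]
  [MeasurableSpace Ω] {μ : Measure Ω} {m : Measure ℝ}
  {ν : Measure (ℝ × ℝ)} {A : Sym2 V₁ → Ω → ℝ} {B : Sym2 V₂ → Ω → ℝ} {Sstar : Finset V₁}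
  {πstar : V₁ → V₂}

namespace IsPartiallyCorrelated

lemma iIndepFun_weightPair (H : IsPartiallyCorrelated μ m ν A B Sstar πstar) :
    iIndepFun (fun k : WeightIndex Sstar πstar => weightPair A B k) μ := by
  convert H.indep using 1
  ext k ω
  all_goals rcases k with e | e | e <;> rfl

lemma measurable_weightPair (H : IsPartiallyCorrelated μ m ν A B Sstar πstar)
    (k : WeightIndex Sstar πstar) : Measurable (weightPair A B k) := by
  match k with
  | .inl e =>
    exact (H.measurable_fst _ (pairs_subset_univ _ e.2)).prodMk
      (H.measurable_snd _ (pairs_subset_univ _ (map_mem_pairs_image H.injOn e.2)))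
  | .inr (.inl e) =>
    exact (H.measurable_fst _ (Finset.mem_sdiff.1 e.2).1).prodMk measurable_const
  | .inr (.inr e) =>
    exact measurable_const.prodMk (H.measurable_snd _ (Finset.mem_sdiff.1 e.2).1)

/-- Weights at vertices of the digraph may be treated as if every vertex carried a correlated
pair of weights, as long as only weights that are really present are used. -/
lemma map_weightPair (H : IsPartiallyCorrelated μ m ν A B Sstar πstar)
    (hfst : ν.map Prod.fst = m) (hsnd : ν.map Prod.snd = m) (k : WeightIndex Sstar πstar)
    (a b : Prop) [Decidable a] [Decidable b]
    (ha : a → ∃ e, weightNode k = Quot.mk _ (.inl e))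
    (hb : b → ∃ e, weightNode k = Quot.mk _ (.inr e)) :
    (μ.map (weightPair A B k)).map
        (fun w => ((if a then w.1 else 0 : ℝ), (if b then w.2 else 0 : ℝ))) =
      ν.map (fun w => ((if a then w.1 else 0 : ℝ), (if b then w.2 else 0 : ℝ))) := by
  have hm := H.measurable_weightPair k
  match k with
  | .inl e =>
    have : μ.map (weightPair A B (.inl e : WeightIndex Sstar πstar)) = ν := H.law_pair e.1 e.2
    rw [this]
  -- An unmerged pair of the first graph is not the head of an arc. Only its first coordinate
  -- survives, and that has the law `m`, the first marginal of `ν`.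
  | .inr (.inl e) =>
    have hb' : ¬ b := fun h => by
      obtain ⟨e', he'⟩ := hb h
      exact weightNode_ne_inr e' he'
    have hg : Measurable fun x : ℝ => ((if a then x else 0 : ℝ), (0 : ℝ)) := by
      split_ifs <;> fun_prop
    have hcomp : (fun w : ℝ × ℝ => ((if a then w.1 else 0 : ℝ), (if b then w.2 else 0 : ℝ))) =
        (fun x : ℝ => ((if a then x else 0 : ℝ), (0 : ℝ))) ∘ Prod.fst := by
      ext w <;> simp [hb']
    rw [hcomp, ← Measure.map_map hg _root_.measurable_fst, ← Measure.map_map hg _root_.measurable_fst, hfst,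
      Measure.map_map _root_.measurable_fst hm]
    congr 1
    exact H.law_fst e.1 (Finset.mem_sdiff.1 e.2).1
  | .inr (.inr e) =>
    have ha' : ¬ a := fun h => by
      obtain ⟨e', he'⟩ := ha h
      exact weightNode_ne_inl H.injOn e' he'
    have hg : Measurable fun x : ℝ => ((0 : ℝ), (if b then x else 0 : ℝ)) := by
      split_ifs <;> fun_prop
    have hcomp : (fun w : ℝ × ℝ => ((if a then w.1 else 0 : ℝ), (if b then w.2 else 0 : ℝ))) =
        (fun x : ℝ => ((0 : ℝ), (if b then x else 0 : ℝ))) ∘ Prod.snd := by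
      ext w <;> simp [ha']
    rw [hcomp, ← Measure.map_map hg _root_.measurable_snd, ← Measure.map_map hg _root_.measurable_snd, hsnd,
      Measure.map_map _root_.measurable_snd hm]
    congr 1
    exact H.law_snd e.1 (Finset.mem_sdiff.1 e.2).1

variable [IsProbabilityMeasure μ]

/-- An expectation over the edge weights of the graphs at the end points of some arcs of the
digraph only depends on the incidences of these arcs. -/
lemma lintegral_prod_eq (H : IsPartiallyCorrelated μ m ν A B Sstar πstar)
    (hfst : ν.map Prod.fst = m) (hsnd : ν.map Prod.snd = m) [IsProbabilityMeasure ν]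
    {S : Finset V₁} {π : V₁ → V₂} (hπ : Set.InjOn π S) {I N : Type*} [Fintype I] [Fintype N]
    {e : I → Sym2 V₁} (he : ∀ i, e i ∈ pairs S) {v : N → Node Sstar πstar}
    (hv : Function.Injective v) {a b : I → N}
    (ha : ∀ i, arcTail Sstar πstar (e i) = v (a i))
    (hb : ∀ i, arcHead Sstar πstar π (e i) = v (b i))
    (hcover : ∀ n, (∃ i, a i = n) ∨ ∃ i, b i = n) {h : ℝ → ℝ → ℝ≥0∞}
    (hh : Measurable fun q : ℝ × ℝ => h q.1 q.2) :
    ∫⁻ ω, ∏ i, h (A (e i) ω) (B ((e i).map π) ω) ∂μ =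
      ∫⁻ w, ∏ i, h (w (a i)).1 (w (b i)).2 ∂(Measure.pi fun _ : N => ν) := by
  classical
  -- Diagonal pairs are vertices that carry no weight; `hcover` rules them out, as every `v n` is an
  -- end point of some arc.
  have hk : ∀ n, ∃ k : WeightIndex Sstar πstar, weightNode k = v n := fun n => by
    rcases hcover n with ⟨i, rfl⟩ | ⟨i, rfl⟩
    · rw [← ha]
      exact exists_weightNode_eq_inl (pairs_subset_univ _ (he i))
    · rw [← hb]
      exact exists_weightNode_eq_inr (pairs_subset_univ _ (map_mem_pairs_image hπ (he i)))
  choose k hk using hk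
  have hkinj : Function.Injective k := fun n n' hn => hv (by rw [← hk, ← hk, hn])
  have hmeas := H.measurable_weightPair
  have hlaw := (iIndepFun_iff_map_fun_eq_pi_map fun n => (hmeas (k n)).aemeasurable).1
    (H.iIndepFun_weightPair.precomp hkinj)
  -- The map `g n` erases the coordinates at `n` that no arc uses. The integrand does not notice
  -- this, and afterwards the actual law at each vertex agrees with that of a full correlated pair.
  set g : N → ℝ × ℝ → ℝ × ℝ := fun n w =>
    ((if ∃ i, a i = n then w.1 else 0 : ℝ), (if ∃ i, b i = n then w.2 else 0 : ℝ)) with hgdef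
  have hg : ∀ n, Measurable (g n) := fun n => by
    simp only [hgdef]
    split_ifs <;> fun_prop
  have hgpi : Measurable fun (w : N → ℝ × ℝ) n => g n (w n) :=
    measurable_pi_lambda _ fun n => (hg n).comp (measurable_pi_apply n)
  have hF : Measurable fun w : N → ℝ × ℝ => ∏ i, h (w (a i)).1 (w (b i)).2 :=
    Finset.measurable_fun_prod _ fun i _ => hh.comp
      (by fun_prop : Measurable fun w : N → ℝ × ℝ => ((w (a i)).1, (w (b i)).2))
  have hinv : ∀ w : N → ℝ × ℝ, ∏ i, h (g (a i) (w (a i))).1 (g (b i) (w (b i))).2 =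
      ∏ i, h (w (a i)).1 (w (b i)).2 := fun w => by
    simp [hgdef]
  have hmap : ∀ n, (μ.map (weightPair A B (k n))).map (g n) = ν.map (g n) := fun n =>
    H.map_weightPair hfst hsnd (k n) _ _
      (by rintro ⟨i, rfl⟩; exact ⟨e i, (hk _).trans (ha i).symm⟩)
      (by rintro ⟨i, rfl⟩; exact ⟨(e i).map π, (hk _).trans (hb i).symm⟩)
  have hprob : ∀ n, IsProbabilityMeasure (μ.map (weightPair A B (k n))) := fun n =>
    Measure.isProbabilityMeasure_map (hmeas _).aemeasurable
  have hprob' : ∀ n, IsProbabilityMeasure ((μ.map (weightPair A B (k n))).map (g n)) := fun n =>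
    Measure.isProbabilityMeasure_map (hg n).aemeasurable
  have hprob'' : ∀ n, IsProbabilityMeasure (ν.map (g n)) := fun n =>
    Measure.isProbabilityMeasure_map (hg n).aemeasurable
  calc _ = ∫⁻ ω, ∏ i, h (weightPair A B (k (a i)) ω).1 (weightPair A B (k (b i)) ω).2 ∂μ := by
        refine lintegral_congr fun ω => Finset.prod_congr rfl fun i _ => ?_
        rw [weightPair_fst H.injOn ((hk _).trans (ha i).symm),
          weightPair_snd ((hk _).trans (hb i).symm)]
    _ = ∫⁻ w, ∏ i, h (w (a i)).1 (w (b i)).2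
          ∂(Measure.pi fun n => μ.map (weightPair A B (k n))) := by
        rw [← hlaw, lintegral_map hF (measurable_pi_lambda _ fun n => hmeas (k n))]
    _ = ∫⁻ w, ∏ i, h (w (a i)).1 (w (b i)).2
          ∂((Measure.pi fun n => μ.map (weightPair A B (k n))).map fun w n => g n (w n)) := by
        rw [lintegral_map hF hgpi]
        exact lintegral_congr fun w => (hinv w).symm
    _ = ∫⁻ w, ∏ i, h (w (a i)).1 (w (b i)).2
          ∂((Measure.pi fun _ : N => ν).map fun w n => g n (w n)) := by
        rw [Measure.pi_map_pi fun n => (hg n).aemeasurable,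
          Measure.pi_map_pi fun n => (hg n).aemeasurable]
        simp only [hmap]
    _ = _ := by
        rw [lintegral_map hF hgpi]
        exact lintegral_congr hinv

end IsPartiallyCorrelated

end Law

/-! ### The total weight of paths, cycles and arbitrary sets of arcs -/

section TotalWeight

lemma ofReal_exp_totalWeight {V₁ V₂ Ω I : Type*} [DecidableEq V₁] [Fintype I]
    {A : Sym2 V₁ → Ω → ℝ} {B : Sym2 V₂ → Ω → ℝ} {S : Finset V₁} {π : V₁ → V₂} {f : ℝ → ℝ → ℝ}
    {t : ℝ} {E : Finset (Sym2 V₁)} (hE : E ⊆ pairs S)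
    {e : I → Sym2 V₁} (he : Function.Injective e) (heE : Finset.univ.image e = E) (ω : Ω) :
    ENNReal.ofReal (Real.exp (t * totalWeight f A B S π E ω)) =
      ∏ i, expScore f t (A (e i) ω) (B ((e i).map π) ω) := by
  subst heE
  rw [totalWeight, ofReal_exp_sum, Finset.prod_image fun i _ j _ h => he h]
  refine Finset.prod_congr rfl fun i _ => ?_
  rw [interWeight, if_pos (hE (Finset.mem_image_of_mem _ (Finset.mem_univ i))), expScore]

variable {V₁ V₂ Ω : Type*} [DecidableEq V₁] [DecidableEq V₂] [Fintype V₁] [Fintype V₂]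
  [MeasurableSpace Ω] {μ : Measure Ω} {m : Measure ℝ}
  {ν : Measure (ℝ × ℝ)} {A : Sym2 V₁ → Ω → ℝ} {B : Sym2 V₂ → Ω → ℝ} {Sstar : Finset V₁}
  {πstar : V₁ → V₂} {S : Finset V₁} {π : V₁ → V₂}
  {Z : Type*} [MeasurableSpace Z] {f : ℝ → ℝ → ℝ} {t : ℝ} {ζ : Measure Z} {Φ : ℝ → Z → ℝ}

lemma IsPartiallyCorrelated.measurable_totalWeight
    (H : IsPartiallyCorrelated μ m ν A B Sstar πstar)
    (hf : Measurable fun q : ℝ × ℝ => f q.1 q.2) (hπ : Set.InjOn π S) (E : Finset (Sym2 V₁)) :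
    Measurable (totalWeight f A B S π E) := by
  refine Finset.measurable_fun_sum _ fun e _ => ?_
  by_cases he : e ∈ pairs S
  · have heq : interWeight f A B S π e = fun ω => f (A e ω) (B (e.map π) ω) :=
      funext fun ω => if_pos he
    rw [heq]
    exact hf.comp ((H.measurable_fst e (pairs_subset_univ _ he)).prodMk
      (H.measurable_snd _ (pairs_subset_univ _ (map_mem_pairs_image hπ he))))
  · have heq : interWeight f A B S π e = fun _ => 0 := funext fun ω => if_neg he
    rw [heq]
    exact measurable_const

lemma injective_of_image_univ_eq {α : Type*} [DecidableEq α] {P : Finset α} {e : Fin P.card → α}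
    (he : Finset.univ.image e = P) : Function.Injective e := by
  have h : Set.InjOn e (Finset.univ : Finset (Fin P.card)) :=
    Finset.card_image_iff.1 (by rw [he]; simp)
  exact fun i j hij => h (by simp) (by simp) hij

variable [IsProbabilityMeasure μ]

namespace IsLatentModel

/-- The moment generating function of the total weight of some arcs of the digraph. -/
lemma lintegral_exp_totalWeight (h : IsLatentModel m ν f t ζ Φ)
    (H : IsPartiallyCorrelated μ m ν A B Sstar πstar) (hπ : Set.InjOn π S) {I N : Type*}
    [Fintype I] [Fintype N] {E : Finset (Sym2 V₁)} (hE : E ⊆ pairs S) {e : I → Sym2 V₁}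
    (he : Function.Injective e) (heE : Finset.univ.image e = E) {v : N → Node Sstar πstar}
    (hv : Function.Injective v) {a b : I → N}
    (ha : ∀ i, arcTail Sstar πstar (e i) = v (a i))
    (hb : ∀ i, arcHead Sstar πstar π (e i) = v (b i))
    (hcover : ∀ n, (∃ i, a i = n) ∨ ∃ i, b i = n) :
    ∫⁻ ω, ENNReal.ofReal (Real.exp (t * totalWeight f A B S π E ω)) ∂μ =
      ∫⁻ w, ∏ i, expScore f t (w (a i)).1 (w (b i)).2 ∂(Measure.pi fun _ : N => ν) := by
  have := h.prob
  rw [← H.lintegral_prod_eq h.map_fst h.map_snd hπ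
    (fun i => hE (heE ▸ Finset.mem_image_of_mem e (Finset.mem_univ i))) hv ha hb hcover
    h.measurable_expScore]
  exact lintegral_congr fun ω => ofReal_exp_totalWeight hE he heE ω

lemma cgf_totalWeight_path (h : IsLatentModel m ν f t ζ Φ)
    (H : IsPartiallyCorrelated μ m ν A B Sstar πstar) (hπ : Set.InjOn π S)
    {P : Finset (Sym2 V₁)} (hP : IsPath Sstar πstar S π P) :
    cgf (totalWeight f A B S π P) μ t = pathCGF ν f P.card t := by
  obtain ⟨hPS, hne, e, v, heP, hv, hev⟩ := hP
  rw [pathCGF, cgf_eq_log_lintegral (h.measurable_pathScore _).aemeasurable,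
    cgf_eq_log_lintegral (H.measurable_totalWeight h.measurable_score hπ P).aemeasurable,
    h.lintegral_exp_totalWeight H hπ hPS (injective_of_image_univ_eq heP) heP hv
      (fun i => (hev i).1) (fun i => (hev i).2)]
  · simp only [pathScore, ofReal_exp_sum, expScore]
  -- The first vertex of a path is a tail, since the path has an arc; every later vertex is a head.
  · intro n
    cases n using Fin.cases with
    | zero => exact Or.inl ⟨⟨0, hne.card_pos⟩, rfl⟩
    | succ i => exact Or.inr ⟨i, rfl⟩

lemma cgf_totalWeight_cycle (h : IsLatentModel m ν f t ζ Φ)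
    (H : IsPartiallyCorrelated μ m ν A B Sstar πstar) (hπ : Set.InjOn π S)
    {C : Finset (Sym2 V₁)} (hC : IsCycle Sstar πstar S π C) :
    cgf (totalWeight f A B S π C) μ t = cycleCGF ν f C.card t := by
  obtain ⟨hCS, -, e, v, heC, hv, hev⟩ := hC
  rw [cycleCGF, cgf_eq_log_lintegral (h.measurable_cycleScore _).aemeasurable,
    cgf_eq_log_lintegral (H.measurable_totalWeight h.measurable_score hπ C).aemeasurable,
    h.lintegral_exp_totalWeight H hπ hCS (injective_of_image_univ_eq heC) heC hv (a := id)
      (fun i => (hev i).1) (fun i => (hev i).2) fun n => Or.inl ⟨n, rfl⟩]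
  simp only [cycleScore, ofReal_exp_sum, expScore, id]

open Classical in
-- All arcs are treated at once by the kernel inequality. The arcs have distinct tails because
-- `πstar` is injective on `Sstar`, and distinct heads because `π` is injective on `S`.
lemma lintegral_exp_totalWeight_le (h : IsLatentModel m ν f t ζ Φ)
    (H : IsPartiallyCorrelated μ m ν A B Sstar πstar) (hπ : Set.InjOn π S)
    {E : Finset (Sym2 V₁)} (hE : E ⊆ pairs S) :
    ∫⁻ ω, ENNReal.ofReal (Real.exp (t * totalWeight f A B S π E ω)) ∂μ ≤
      ∏ e ∈ E, if arcTail Sstar πstar e = arcHead Sstar πstar π e then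
        kernelTrace m (latentKernel ζ Φ (expScore f t))
        else kernelSq m (latentKernel ζ Φ (expScore f t)) ^ (1 / 2 : ℝ) := by
  have := h.prob_vertex
  have := h.prob_noise
  -- Only end points of arcs are kept, which gives a finite index set whose members all carry
  -- weights.
  set s : Finset (Node Sstar πstar) :=
    E.image (arcTail Sstar πstar) ∪ E.image (arcHead Sstar πstar π) with hs
  have ht : ∀ e : E, arcTail Sstar πstar e.1 ∈ s := fun e =>
    Finset.mem_union_left _ (Finset.mem_image_of_mem _ e.2)
  have hd : ∀ e : E, arcHead Sstar πstar π e.1 ∈ s := fun e =>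
    Finset.mem_union_right _ (Finset.mem_image_of_mem _ e.2)
  rw [h.lintegral_exp_totalWeight H hπ hE (e := fun e : E => e.1) Subtype.val_injective (by simp)
    (v := fun n : s => n.1) Subtype.val_injective (a := fun e => ⟨_, ht e⟩)
    (b := fun e => ⟨_, hd e⟩) (fun e => rfl) (fun e => rfl)]
  · have ha : Function.Injective fun e : E => (⟨_, ht e⟩ : s) := fun e e' hee =>
      Subtype.ext (mk_inl_injective H.injOn (congrArg Subtype.val hee))
    have hb : Function.Injective fun e : E => (⟨_, hd e⟩ : s) := fun e e' hee =>
      Subtype.ext (map_injOn_pairs hπ (hE e.2) (hE e'.2)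
        (mk_inr_injective (congrArg Subtype.val hee)))
    rw [h.law_eq, lintegral_pi_latentLaw h.measurable_latent h.measurable_expScore ha hb]
    refine (lintegral_pi_prod_kernel_le h.measurable_kernel ha hb).trans (le_of_eq ?_)
    rw [← Finset.prod_coe_sort E]
    refine Finset.prod_congr rfl fun e _ => ?_
    simp only [Subtype.mk.injEq]
  · rintro ⟨n, hn⟩
    rcases Finset.mem_union.1 hn with hn | hn
    · obtain ⟨e, he, rfl⟩ := Finset.mem_image.1 hn
      exact Or.inl ⟨⟨e, he⟩, rfl⟩
    · obtain ⟨e, he, rfl⟩ := Finset.mem_image.1 hn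
      exact Or.inr ⟨⟨e, he⟩, rfl⟩

lemma totalWeight_bound (h : IsLatentModel m ν f t ζ Φ)
    (H : IsPartiallyCorrelated μ m ν A B Sstar πstar) (hπ : Set.InjOn π S)
    {E : Finset (Sym2 V₁)} (hE : E ⊆ pairs S) :
    Integrable (fun ω => Real.exp (t * totalWeight f A B S π E ω)) μ ∧
      cgf (totalWeight f A B S π E) μ t ≤
        (E.card : ℝ) / 2 * cycleCGF ν f 2 t +
          (selfLoops Sstar πstar π E : ℝ) * (cycleCGF ν f 1 t - 1 / 2 * cycleCGF ν f 2 t) := by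
  classical
  have hX := (H.measurable_totalWeight h.measurable_score hπ E).aemeasurable (μ := μ)
  have hle := h.lintegral_exp_totalWeight_le H hπ hE
  have hT := h.kernelTrace_lt_top
  have hQ := h.kernelSq_lt_top
  have hT' := ENNReal.toReal_pos (h.cycle_pos 0).ne' hT.ne
  have hQ' := ENNReal.toReal_pos h.kernelSq_pos.ne' hQ.ne
  have hlt : (∏ e ∈ E, if arcTail Sstar πstar e = arcHead Sstar πstar π e then
        kernelTrace m (latentKernel ζ Φ (expScore f t))
        else kernelSq m (latentKernel ζ Φ (expScore f t)) ^ (1 / 2 : ℝ)) < ∞ := by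
    refine ENNReal.prod_lt_top fun e _ => ?_
    split_ifs
    exacts [hT, ENNReal.rpow_lt_top_of_nonneg (by norm_num) hQ.ne]
  refine ⟨integrable_exp_of_lintegral hX (hle.trans_lt hlt), ?_⟩
  rw [cgf_eq_log_lintegral hX]
  refine (log_toReal_le (lintegral_exp_pos μ hX t) hlt hle).trans (le_of_eq ?_)
  rw [ENNReal.toReal_prod, Real.log_prod]
  -- Each arc contributes half the cumulant of a 2-cycle, and a self-loop additionally its excess
  -- over that.
  · have hterm : ∀ e ∈ E, Real.log (if arcTail Sstar πstar e = arcHead Sstar πstar π e then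
        kernelTrace m (latentKernel ζ Φ (expScore f t))
        else kernelSq m (latentKernel ζ Φ (expScore f t)) ^ (1 / 2 : ℝ)).toReal =
        1 / 2 * cycleCGF ν f 2 t + if arcTail Sstar πstar e = arcHead Sstar πstar π e then
          cycleCGF ν f 1 t - 1 / 2 * cycleCGF ν f 2 t else 0 := fun e _ => by
      split_ifs
      · rw [h.cycleCGF_one]; ring
      · rw [← ENNReal.toReal_rpow, Real.log_rpow hQ', h.cycleCGF_two]; ring
    rw [Finset.sum_congr rfl hterm, Finset.sum_add_distrib, ← Finset.sum_filter, Finset.sum_const,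
      Finset.sum_const, nsmul_eq_mul, nsmul_eq_mul, selfLoops]
    congr 1
    ring
  · intro e _
    split_ifs
    · exact hT'.ne'
    · rw [← ENNReal.toReal_rpow]
      exact (Real.rpow_pos_of_pos hQ' _).ne'

end IsLatentModel

end TotalWeight

end CorrelatedGraphs

end

/-! ### Assembly of the result -/

open CorrelatedGraphs

/-- The noise space differs between the models: a coin with a fresh bit for Bernoulli weights, a
single normal variable for Gaussian ones. -/
lemma exists_isLatentModel (p ρ t : ℝ) (hp₀ : 0 < p) (hp₁ : p < 1) (hρ₀ : 0 < ρ) (hρ₁ : ρ < 1)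
    (m : Measure ℝ) (ν : Measure (ℝ × ℝ)) (f : ℝ → ℝ → ℝ)
    (hmodel :
      (m = bernoulliLaw p ∧ ν = bivariateBernoulliLaw p ρ ∧
        f = (fun x y => x * y) ∧ 0 < t) ∨
      (m = gaussianReal 0 1 ∧ ν = bivariateNormalLaw ρ ∧
        f = (fun x y => x * y) ∧ 0 < t ∧ t < 1 / (1 + ρ)) ∨
      (m = gaussianReal 0 1 ∧ ν = bivariateNormalLaw ρ ∧
        f = (fun x y => -(1 / 2) * (x - y) ^ 2) ∧ 0 < t)) :
    ∃ (Z : Type) (_ : MeasurableSpace Z) (ζ : Measure Z) (Φ : ℝ → Z → ℝ),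
      IsLatentModel m ν f t ζ Φ := by
  rcases hmodel with ⟨rfl, rfl, rfl, ht⟩ | ⟨rfl, rfl, rfl, ht, ht'⟩ | ⟨rfl, rfl, rfl, ht⟩
  · exact ⟨_, _, _, _, isLatentModel_bernoulli hp₀.le hp₁.le hρ₀.le hρ₁.le ht.le⟩
  · exact ⟨_, _, _, _, isLatentModel_normal_mul hρ₀.le hρ₁.le ht.le ht'⟩
  · exact ⟨_, _, _, _, isLatentModel_normal_sq_sub hρ₀.le hρ₁.le ht.le⟩

theorem lemma1 (p ρ t : ℝ) (hp₀ : 0 < p) (hp₁ : p < 1) (hρ₀ : 0 < ρ) (hρ₁ : ρ < 1)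
    (m : Measure ℝ) (ν : Measure (ℝ × ℝ)) (f : ℝ → ℝ → ℝ)
    (hmodel :
      (m = bernoulliLaw p ∧ ν = bivariateBernoulliLaw p ρ ∧
        f = (fun x y => x * y) ∧ 0 < t) ∨
      (m = gaussianReal 0 1 ∧ ν = bivariateNormalLaw ρ ∧
        f = (fun x y => x * y) ∧ 0 < t ∧ t < 1 / (1 + ρ)) ∨
      (m = gaussianReal 0 1 ∧ ν = bivariateNormalLaw ρ ∧
        f = (fun x y => -(1 / 2) * (x - y) ^ 2) ∧ 0 < t)) :
    -- the moment generating functions of paths and cycles are finite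
    (∀ ℓ : ℕ,
      Integrable (fun w => Real.exp (t * pathScore f ℓ w)) (Measure.pi fun _ => ν) ∧
      Integrable (fun w => Real.exp (t * cycleScore f ℓ w)) (Measure.pi fun _ => ν)) ∧
    -- the bounds on the cumulant generating functions
    (pathCGF ν f 1 t ≤ 1 / 2 * cycleCGF ν f 2 t ∧
      1 / 2 * cycleCGF ν f 2 t ≤ cycleCGF ν f 1 t ∧
      ∀ ℓ : ℕ, 2 ≤ ℓ →
        pathCGF ν f ℓ t ≤ cycleCGF ν f ℓ t ∧
        cycleCGF ν f ℓ t ≤ (ℓ : ℝ) / 2 * cycleCGF ν f 2 t) ∧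
    -- the consequence for the correlated graphs
    ∀ (V₁ V₂ Ω : Type*) [Fintype V₁] [DecidableEq V₁] [Fintype V₂] [DecidableEq V₂]
      [MeasurableSpace Ω] (μ : Measure Ω) [IsProbabilityMeasure μ]
      (A : Sym2 V₁ → Ω → ℝ) (B : Sym2 V₂ → Ω → ℝ)
      (Sstar : Finset V₁) (πstar : V₁ → V₂) (S : Finset V₁) (π : V₁ → V₂),
      IsPartiallyCorrelated μ m ν A B Sstar πstar → Set.InjOn π S →
      -- the cumulant generating functions of the paths and cycles of the digraph
      (∀ P, IsPath Sstar πstar S π P →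
        cgf (totalWeight f A B S π P) μ t = pathCGF ν f P.card t) ∧
      (∀ C, IsCycle Sstar πstar S π C →
        cgf (totalWeight f A B S π C) μ t = cycleCGF ν f C.card t) ∧
      -- the bound for an arbitrary set of pairs
      ∀ E ⊆ pairs S,
        Integrable (fun ω => Real.exp (t * totalWeight f A B S π E ω)) μ ∧
        cgf (totalWeight f A B S π E) μ t ≤
          (E.card : ℝ) / 2 * cycleCGF ν f 2 t +
            (selfLoops Sstar πstar π E : ℝ) *
              (cycleCGF ν f 1 t - 1 / 2 * cycleCGF ν f 2 t) := by
  obtain ⟨Z, _, ζ, Φ, h⟩ := exists_isLatentModel p ρ t hp₀ hp₁ hρ₀ hρ₁ m ν f hmodel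
  refine ⟨fun ℓ => ⟨h.integrable_path ℓ, h.integrable_cycle ℓ⟩,
    ⟨h.pathCGF_one_le, h.cycleCGF_two_le, fun ℓ hℓ => ?_⟩, ?_⟩
  · obtain ⟨n, rfl⟩ := Nat.exists_eq_add_of_le' hℓ
    exact ⟨h.pathCGF_le_cycleCGF (n + 1), h.cycleCGF_le n⟩
  · intro V₁ V₂ Ω _ _ _ _ _ μ _ A B Sstar πstar S π H hπ
    exact ⟨fun P hP => h.cgf_totalWeight_path H hπ hP, fun C hC => h.cgf_totalWeight_cycle H hπ hC,
      fun E hE => h.totalWeight_bound H hπ hE⟩
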